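/- Let $s\in\mathbb N$. There is an integer $m=m(s)$ such that the following holds for every $T>0$, $t_0\in\mathbb R$, every finite-dimensional real normed space $E$ (e.g. $E=\mathbb R$) and all distinct real numbers $c_1,\dots,c_s$ satisfying $$\int_0^1\!\int_0^{1+x}\!\int_0^t\prod_{i=1}^s(\xi-c_i)\,d\xi\,dt\,dx=0,\qquad \int_0^1\xi^k\prod_{i=1}^s(\xi-c_i)\,d\xi=0\quad(k=0,1,2).$$ **The methods.** Put $I=[t_0,t_0+T]$. Let $u_1,\dots,u_s:I\to\mathbb R$ be of class $C^m$ and assume that the Wronskian $\det\big(u_i^{(k+2)}(t)\big)_{0\le k\le s-1,\,1\le i\le s}$ of $u_1'',\dots,u_s''$ has no zero on $I$. An $s$-stage FEPTRKN method for the basis $(u_i)$ consists of the $c_j$ and of coefficients $A(t,h)=(a_{kj}(t,h))$, $b(t,h)$, $d(t,h)$ such that, whenever $h>0$, the points $t$, $t+h$ and all $t+c_jh$ lie in $I$ and the matrix $\big(u_i''(t+c_jh)\big)_{j,i}$ is nonsingular, for all $i$ $$u_i(t+h)=u_i(t)+hu_i'(t)+h^2\sum_j b_ju_i''(t+c_jh),\qquad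 u_i'(t+h)=u_i'(t)+h\sum_j d_ju_i''(t+c_jh),$$ and, for each $k$ with $t+h+c_kh\in I$, $$u_i(t+h+c_kh)=u_i(t+h)+hc_ku_i'(t+h)+h^2\sum_j a_{kj}u_i''(t+c_jh).$$ For $y''=f(t,y)$, one step from $(t_n;y_n,y_n',Y_n)$ with $Y_n=(Y_{n,1},\dots,Y_{n,s})$ is $$y_{n+1}=y_n+hy_n'+h^2\sum_j b_j(t_n,h)f(t_n+c_jh,Y_{n,j}),\qquad y_{n+1}'=y_n'+h\sum_j d_j(t_n,h)f(t_n+c_jh,Y_{n,j}),$$ $$Y_{n+1,k}=y_{n+1}+hc_ky_{n+1}'+h^2\sum_j a_{kj}(t_n,h)f(t_n+c_jh,Y_{n,j}).$$ **The claim.** Every such method has step order $p=s+3$, in the following sense. Let $f:I\times E\to E$ be of class $C^m$ and let $y:I\to E$ solve $y''(t)=f(t,y(t))$. For every $K_0$ there are $K$ and $h_0>0$ such that for all $0<h\le h_0$, every starting time $\tau$ with grid $t_n=\tau+nh$, and every starting stage vector with $\|y(\tau+c_ih)-Y_{0,i}\|\le K_0h^{s+3}$ for all $i$, the following is true. Let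 each step $n=0,1,2,\dots$ be taken from the exact values $y_n=y(t_n)$, $y_n'=y'(t_n)$ and from the stage vector $Y_n$ that the preceding step produced. Then $$\|y(t_{n+1})-y_{n+1}\|\le Kh^{s+4},\qquad \|y'(t_{n+1})-y_{n+1}'\|\le Kh^{s+4}$$ for every $n$ such that $t_k$, $t_{k+1}$ and all $t_k+c_ih$ lie in $I$ for $0\le k\le n$. In particular the same conclusion holds, without any Wronskian assumption, for the classical EPTRKN methods, that is, for the basis $t^2,t^3,\dots,t^{s+1}$. -/

import Mathlib

open Set

/-- The coefficients of an `s`-stage explicit pseudo two-step Runge-Kutta-Nystrom method: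
collocation parameters `c` and coefficients `A`, `b`, `d` that may depend on the current time `t`
and on the stepsize `h`. -/
structure PseudoTwoStepRKN (s : ℕ) where
  c : Fin s → ℝ
  A : ℝ → ℝ → Matrix (Fin s) (Fin s) ℝ
  b : ℝ → ℝ → Fin s → ℝ
  d : ℝ → ℝ → Fin s → ℝ

namespace PseudoTwoStepRKN

variable {s : ℕ} {E : Type*} [NormedAddCommGroup E] [NormedSpace ℝ E]

/-- `y_{n+1} = y_n + h y'_n + h² bᵀ f(e t_n + c h, Y_n)`. -/
noncomputable def nextY (M : PseudoTwoStepRKN s) (f : ℝ → E → E) (t h : ℝ) (y y' : E)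
    (Y : Fin s → E) : E :=
  y + h • y' + h ^ 2 • ∑ j, M.b t h j • f (t + M.c j * h) (Y j)

/-- `y'_{n+1} = y'_n + h dᵀ f(e t_n + c h, Y_n)`. -/
noncomputable def nextY' (M : PseudoTwoStepRKN s) (f : ℝ → E → E) (t h : ℝ) (y' : E)
    (Y : Fin s → E) : E :=
  y' + h • ∑ j, M.d t h j • f (t + M.c j * h) (Y j)

/-- `Y_{n+1} = e y_{n+1} + h c y'_{n+1} + h² A f(e t_n + c h, Y_n)`. -/
noncomputable def nextStage (M : PseudoTwoStepRKN s) (f : ℝ → E → E) (t h : ℝ) (y y' : E)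
    (Y : Fin s → E) : Fin s → E := fun i =>
  M.nextY f t h y y' Y + (h * M.c i) • M.nextY' f t h y' Y
    + h ^ 2 • ∑ j, M.A t h i j • f (t + M.c j * h) (Y j)

/-- The matrix `F(t, h)` with entry `u_i''(t + c_j h)` in row `j` and column `i`. -/
noncomputable def collocationMatrix (I : Set ℝ) (u : Fin s → ℝ → ℝ) (c : Fin s → ℝ) (t h : ℝ) :
    Matrix (Fin s) (Fin s) ℝ :=
  Matrix.of fun j i => iteratedDerivWithin 2 (u i) I (t + c j * h)

/-- `M` is functionally fitted on the interval `I` with respect to `u_1, …, u_s`: whenever the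
points involved lie in `I` and `F(t, h)` is nonsingular, the scheme integrates each `u_i` exactly.
(The row of `A(t, h)` that belongs to a stage beyond the end of `I` is never used and is left
unconstrained.) -/
def IsFunctionallyFitted (M : PseudoTwoStepRKN s) (I : Set ℝ) (u : Fin s → ℝ → ℝ) : Prop :=
  ∀ t h : ℝ, 0 < h → t ∈ I → t + h ∈ I → (∀ j, t + M.c j * h ∈ I) →
    (collocationMatrix I u M.c t h).det ≠ 0 →
    ∀ i,
      u i (t + h) = u i t + h * derivWithin (u i) I t
        + h ^ 2 * ∑ j, M.b t h j * iteratedDerivWithin 2 (u i) I (t + M.c j * h) ∧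
      derivWithin (u i) I (t + h) = derivWithin (u i) I t
        + h * ∑ j, M.d t h j * iteratedDerivWithin 2 (u i) I (t + M.c j * h) ∧
      ∀ k, t + h + M.c k * h ∈ I →
        u i (t + h + M.c k * h) = u i (t + h) + h * M.c k * derivWithin (u i) I (t + h)
          + h ^ 2 * ∑ j, M.A t h k j * iteratedDerivWithin 2 (u i) I (t + M.c j * h)

/-- `y` solves `y'' = f(t, y)` on `I`, with first derivative `v`. -/
def IsSolutionOn (I : Set ℝ) (f : ℝ → E → E) (y v : ℝ → E) : Prop :=
  ∀ t ∈ I, HasDerivWithinAt y (v t) I t ∧ HasDerivWithinAt v (f t (y t)) I t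

/-- The stage vectors `Y_0, Y_1, …` that the method itself generates from `Y_0` with stepsize `h`
on the grid `t_n = τ + n h`, each step being taken from the exact values `y_n = y(t_n)` and
`y'_n = y'(t_n)`. -/
def IsLocalRun (M : PseudoTwoStepRKN s) (f : ℝ → E → E) (y v : ℝ → E) (τ h : ℝ)
    (Y : ℕ → Fin s → E) : Prop :=
  ∀ n : ℕ, Y (n + 1) =
    M.nextStage f (τ + n * h) h (y (τ + n * h)) (v (τ + n * h)) (Y n)

/-- Step order (at least) `p` on `[t₀, t₀ + T]` for problems in `E` with right-hand side of class
`C^m`, the starting stage vector `Y_0` having accuracy `O(h^q)`: with `y_n = y(t_n)` and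
`y'_n = y'(t_n)`, the errors `y(t_{n+1}) - y_{n+1}` and `y'(t_{n+1}) - y'_{n+1}` are `O(h^{p+1})`,
uniformly over all steps of all runs whose grid points and nodes up to that step lie in the
interval. -/
def HasStepOrder (E : Type*) [NormedAddCommGroup E] [NormedSpace ℝ E]
    (M : PseudoTwoStepRKN s) (t₀ T : ℝ) (m q p : ℕ) : Prop :=
  ∀ (f : ℝ → E → E) (y v : ℝ → E),
    ContDiffOn ℝ m (fun z : ℝ × E => f z.1 z.2) (Icc t₀ (t₀ + T) ×ˢ univ) →
    IsSolutionOn (Icc t₀ (t₀ + T)) f y v →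
    ∀ K₀ : ℝ, ∃ K h₀ : ℝ, 0 < h₀ ∧
      ∀ (τ h : ℝ) (Y : ℕ → Fin s → E), 0 < h → h ≤ h₀ →
        M.IsLocalRun f y v τ h Y →
        (∀ i, ‖y (τ + M.c i * h) - Y 0 i‖ ≤ K₀ * h ^ q) →
        ∀ n : ℕ,
          (∀ k ≤ n, τ + k * h ∈ Icc t₀ (t₀ + T) ∧ τ + k * h + h ∈ Icc t₀ (t₀ + T) ∧
            ∀ i, τ + k * h + M.c i * h ∈ Icc t₀ (t₀ + T)) →
          ‖y (τ + n * h + h)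
              - M.nextY f (τ + n * h) h (y (τ + n * h)) (v (τ + n * h)) (Y n)‖
            ≤ K * h ^ (p + 1) ∧
          ‖v (τ + n * h + h)
              - M.nextY' f (τ + n * h) h (v (τ + n * h)) (Y n)‖
            ≤ K * h ^ (p + 1)

end PseudoTwoStepRKN

/-- The Wronskian at `t` of the second derivatives `u_1'', …, u_s''`. -/
noncomputable def wronskianSnd {s : ℕ} (I : Set ℝ) (u : Fin s → ℝ → ℝ) (t : ℝ) : ℝ :=
  (Matrix.of fun k i : Fin s => iteratedDerivWithin ((k : ℕ) + 2) (u i) I t).det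

/-- The basis `t², t³, …, t^{s+1}` of the classical (polynomial) EPTRKN methods. -/
def monomialBasis (s : ℕ) : Fin s → ℝ → ℝ := fun i t => t ^ ((i : ℕ) + 2)

/-- The triple-integral condition together with the orthogonality conditions for `k = 0, 1, 2`. -/
def SuperconvergenceConditions {s : ℕ} (c : Fin s → ℝ) : Prop :=
  (∫ x in (0 : ℝ)..1, ∫ t in (0 : ℝ)..(1 + x), ∫ ξ in (0 : ℝ)..t, ∏ i, (ξ - c i)) = 0 ∧
  ∀ k : ℕ, k ≤ 2 → (∫ ξ in (0 : ℝ)..1, ξ ^ k * ∏ i, (ξ - c i)) = 0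

/-!
The step order rests on the shape of the stage errors. Write `t` for the current time and
`g x = f x (y x)`.

*Classical weights.* Let `d₀`, `b₀`, `A₀` be the interpolatory weights of the polynomial method.
Orthogonality of `∏ (ξ - c i)` to `1, ξ, ξ²` makes `d₀` exact in degree less than `s + 3` and `b₀`
exact in degree less than `s + 2`, so that both quadratures have residual `O(h ^ (s + 4))`. The
stage formula is exact in degree less than `s` only, and its residual is
`h ^ (s + 2) * γ i • q t + O(h ^ (s + 3))`, where the numbers `γ i` depend only on `c` and the
vector `q t` does not depend on the stage `i`. As a function of `c i`, `γ i` is a polynomial of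
degree at most `s + 2`, hence `∑ d₀ j * γ j` is its integral over `[0, 1]`; this is the triple
integral, which vanishes (`SuperconvergenceConditions.exists_isClassicalWeights`).

*Functionally fitted weights.* Put `φ i = u i''`. As the Wronskian has no zero, the span of the
`φ i` contains, up to `O(|x - t| ^ s)` and with bounded coefficients, every monomial `(x - t) ^ k`
with `k < s` (`exists_local_monomials`). Therefore the values on the `φ i` of a functional
`∑ j, D j * φ (t + c j * h)` determine `D` (`exists_norm_weights_le`), which shows both that the
collocation matrix is nonsingular for small `h` and that the fitted weights differ from the
classical ones by `O(h)`: on the `φ i`, the difference of the two is a residual of the classical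
weights. The same comparison carries the residual orders over from the classical to the fitted
weights (`norm_fitted_residual_le`, `PseudoTwoStepRKN.IsFunctionallyFitted.exists_residual_le`);
only the vector `q t` changes.

*Nonlinear step.* In a local run each step starts from exact values, so stage errors enter the next
stage vector with a factor `h ^ 2`. By induction they have the form `γ j • p + O(h ^ (s + 3))` with
`p = O(h ^ (s + 2))`. Linearizing `f` at time `t` (`exists_linearization`), the leading part
contributes `h • P (∑ d j * γ j • p)` to `y'`, which is `O(h ^ (s + 4))` because `d = d₀ + O(h)`
and `d₀` annihilates `γ`; its contribution to `y` carries a factor `h ^ 2`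
(`PseudoTwoStepRKN.exists_local_error_le`).
-/

/-! ### Polynomial quadrature at the collocation parameters -/

section Quadrature

open Polynomial

/-- The antiderivative with value `0` at `0` of a real polynomial. -/
noncomputable def polyAntideriv : ℝ[X] →ₗ[ℝ] ℝ[X] :=
  Polynomial.lsum fun k => ((k : ℝ) + 1)⁻¹ • Polynomial.monomial (k + 1)

theorem polyAntideriv_monomial (k : ℕ) (a : ℝ) :
    polyAntideriv (monomial k a) = monomial (k + 1) (a / (k + 1)) := by
  simp [polyAntideriv, smul_monomial, div_eq_inv_mul]

theorem derivative_polyAntideriv (p : ℝ[X]) : derivative (polyAntideriv p) = p := by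
  induction p using Polynomial.induction_on' with
  | add p q hp hq => simp [hp, hq]
  | monomial k a =>
    have : (k : ℝ) + 1 ≠ 0 := by positivity
    rw [polyAntideriv_monomial, derivative_monomial]
    push_cast
    rw [div_mul_cancel₀ _ this]

theorem natDegree_polyAntideriv_le (p : ℝ[X]) :
    (polyAntideriv p).natDegree ≤ p.natDegree + 1 := by
  rw [polyAntideriv, lsum_apply, Polynomial.sum_def]
  refine natDegree_sum_le_of_forall_le _ _ fun k hk => ?_
  simp only [LinearMap.smul_apply, smul_monomial]
  exact (natDegree_monomial_le _).trans (by have := le_natDegree_of_mem_supp _ hk; omega)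

theorem integral_eval_eq_polyAntideriv (p : ℝ[X]) (z : ℝ) :
    ∫ x in (0 : ℝ)..z, p.eval x = (polyAntideriv p).eval z := by
  have h0 : (polyAntideriv p).eval 0 = 0 := by
    induction p using Polynomial.induction_on' with
    | add p q hp hq => simp [hp, hq]
    | monomial k a => simp [polyAntideriv_monomial]
  rw [intervalIntegral.integral_eq_sub_of_hasDerivAt (f := fun x => (polyAntideriv p).eval x)
    (fun x _ => by simpa [derivative_polyAntideriv] using (polyAntideriv p).hasDerivAt x)
    (p.continuous.intervalIntegrable _ _), h0, sub_zero]

theorem polyAntideriv_X_pow (k : ℕ) (z : ℝ) :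
    (polyAntideriv (X ^ k)).eval z = z ^ (k + 1) / (k + 1) := by
  rw [X_pow_eq_monomial, polyAntideriv_monomial]
  simp [div_eq_inv_mul]

theorem polyAntideriv_polyAntideriv_X_pow (k : ℕ) (z : ℝ) :
    (polyAntideriv (polyAntideriv (X ^ k))).eval z = z ^ (k + 2) / ((k + 1) * (k + 2)) := by
  rw [X_pow_eq_monomial, polyAntideriv_monomial, polyAntideriv_monomial]
  have h1 : (k : ℝ) + 1 ≠ 0 := by positivity
  have h2 : (k : ℝ) + 2 ≠ 0 := by positivity
  have h3 : (k : ℝ) + 1 + 1 ≠ 0 := by positivity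
  simp only [eval_monomial]
  push_cast
  field_simp
  ring

/-- The double integral `∫₀¹ ∫₀ᵗ p` equals `∫₀¹ (1 - ξ) p(ξ) dξ`. -/
theorem polyAntideriv_polyAntideriv_eval_one (p : ℝ[X]) :
    (polyAntideriv (polyAntideriv p)).eval 1 = (polyAntideriv ((1 - X) * p)).eval 1 := by
  induction p using Polynomial.induction_on' with
  | add p q hp hq => simp [hp, hq, mul_add]
  | monomial k a =>
    have h1 : (k : ℝ) + 1 ≠ 0 := by positivity
    have h2 : (k : ℝ) + 2 ≠ 0 := by positivity
    have h3 : (k : ℝ) + 1 + 1 ≠ 0 := by positivity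
    rw [sub_mul, one_mul, X_mul_monomial, map_sub]
    simp only [polyAntideriv_monomial, eval_monomial, eval_sub]
    push_cast
    field_simp
    ring

/-- Interpolatory weights for a linear functional `L` on polynomials: the quadrature error of `p`
is the value of `L` at the multiple of the nodal polynomial that is left by division. -/
theorem exists_interpolatory_weights {s : ℕ} {c : Fin s → ℝ} (hc : Function.Injective c)
    (L : ℝ[X] →ₗ[ℝ] ℝ) :
    ∃ w : Fin s → ℝ, ∀ p : ℝ[X], ∑ j, w j * p.eval (c j) =
      L p - L (Lagrange.nodal Finset.univ c * (p /ₘ Lagrange.nodal Finset.univ c)) := by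
  refine ⟨fun j => L (Lagrange.basis Finset.univ c j), fun p => ?_⟩
  set ω := Lagrange.nodal Finset.univ c with hω
  have hmon : ω.Monic := Lagrange.nodal_monic
  have hdeg : (p %ₘ ω).degree < (Finset.univ : Finset (Fin s)).card := by
    rw [← Lagrange.degree_nodal (v := c)]
    exact degree_modByMonic_lt _ hmon
  have hev : ∀ j, (p %ₘ ω).eval (c j) = p.eval (c j) := by
    intro j
    conv_rhs => rw [← modByMonic_add_div p ω]
    simp [hω, Lagrange.eval_nodal_at_node]
  have hint := Lagrange.eq_interpolate hc.injOn hdeg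
  have : L (p %ₘ ω) = ∑ j, L (Lagrange.basis Finset.univ c j) * p.eval (c j) := by
    conv_lhs => rw [hint, Lagrange.interpolate_apply]
    rw [map_sum]
    refine Finset.sum_congr rfl fun j _ => ?_
    rw [C_mul', map_smul, hev, smul_eq_mul, mul_comm]
  rw [← this, modByMonic_eq_sub_mul_div, map_sub]

/-- The moment conditions satisfied by the weights of the classical polynomial method at the
parameters `c`: `d` and `b` are exact for `∫₀¹ p` and `∫₀¹ (1 - ξ) p(ξ) dξ` on polynomials of degree
less than `s + 3` and `s + 2`, the `i`-th row of `A` is exact for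
`∫₁^{1 + c_i} (1 + c_i - ξ) p(ξ) dξ` in degree less than `s` and has defect `γ i` in degree `s`, and
`d` annihilates these defects. -/
structure IsClassicalWeights {s : ℕ} (c d b : Fin s → ℝ) (A : Fin s → Fin s → ℝ)
    (γ : Fin s → ℝ) : Prop where
  d_moment : ∀ k < s + 3, ∑ j, d j * c j ^ k = 1 / ((k : ℝ) + 1)
  b_moment : ∀ k < s + 2, ∑ j, b j * c j ^ k = 1 / (((k : ℝ) + 1) * (k + 2))
  A_moment : ∀ i, ∀ k < s, ∑ j, A i j * c j ^ k =
    ((1 + c i) ^ (k + 2) - 1) / (((k : ℝ) + 1) * (k + 2)) - c i / (k + 1)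
  A_defect : ∀ i, ∑ j, A i j * c j ^ s + γ i =
    ((1 + c i) ^ (s + 2) - 1) / (((s : ℝ) + 1) * (s + 2)) - c i / (s + 1)
  sum_d_mul_defect : ∑ j, d j * γ j = 0

/-- Interpolatory weights have the required moments. Orthogonality of the nodal polynomial to
`1, ξ, ξ²` raises the degree of exactness of `d` by three and that of `b` by two. The defects `γ` of
`A` are the values at `c` of a polynomial of degree at most `s + 2`, whose integral over `[0, 1]` is
the triple integral. -/
theorem SuperconvergenceConditions.exists_isClassicalWeights {s : ℕ} {c : Fin s → ℝ}
    (hS : SuperconvergenceConditions c) (hc : Function.Injective c) :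
    ∃ (d b : Fin s → ℝ) (A : Fin s → Fin s → ℝ) (γ : Fin s → ℝ), IsClassicalWeights c d b A γ := by
  set ω := Lagrange.nodal Finset.univ c with hω
  have hmon : ω.Monic := Lagrange.nodal_monic
  have hωdeg : ω.natDegree = s := by simp [hω, Lagrange.natDegree_nodal]
  have hωev : ∀ ξ, ∏ i, (ξ - c i) = ω.eval ξ := fun ξ => by rw [hω, Lagrange.eval_nodal]
  let ev : ℝ → ℝ[X] →ₗ[ℝ] ℝ := fun z => Polynomial.leval z
  let Ld : ℝ[X] →ₗ[ℝ] ℝ := (ev 1).comp polyAntideriv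
  let Lb : ℝ[X] →ₗ[ℝ] ℝ := (ev 1).comp (polyAntideriv.comp polyAntideriv)
  let LA : ℝ → ℝ[X] →ₗ[ℝ] ℝ := fun x =>
    (ev (1 + x)).comp (polyAntideriv.comp polyAntideriv) - Lb - x • Ld
  have Ld_apply : ∀ p, Ld p = (polyAntideriv p).eval 1 := fun p => rfl
  have Lb_apply : ∀ p, Lb p = (polyAntideriv (polyAntideriv p)).eval 1 := fun p => rfl
  have LA_apply : ∀ x p, LA x p =
      (polyAntideriv (polyAntideriv p)).eval (1 + x) - Lb p - x * Ld p := fun x p => rfl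
  -- orthogonality of the nodal polynomial to all polynomials of degree at most two
  have hX : ∀ k ≤ 2, Ld (ω * X ^ k) = 0 := by
    intro k hk
    rw [Ld_apply, ← integral_eval_eq_polyAntideriv]
    refine (intervalIntegral.integral_congr fun x _ => ?_).trans (hS.2 k hk)
    simp [hωev, mul_comm]
  have horth : ∀ q : ℝ[X], q.natDegree ≤ 2 → Ld (ω * q) = 0 := by
    intro q hq
    rw [q.as_sum_range' 3 (by omega), Finset.mul_sum, map_sum]
    refine Finset.sum_eq_zero fun k hk => ?_
    rw [← C_mul_X_pow_eq_monomial, mul_left_comm, C_mul', map_smul,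
      hX k (by have := Finset.mem_range.1 hk; omega), smul_zero]
  have horthb : ∀ q : ℝ[X], q.natDegree ≤ 1 → Lb (ω * q) = 0 := by
    intro q hq
    rw [Lb_apply, polyAntideriv_polyAntideriv_eval_one, ← Ld_apply, mul_left_comm]
    refine horth _ (natDegree_mul_le.trans ?_)
    have : (1 - X : ℝ[X]).natDegree ≤ 1 := (natDegree_sub_le 1 X).trans (by simp)
    omega
  have hLdω : Ld ω = 0 := by simpa using horth 1 (by simp)
  have hLbω : Lb ω = 0 := by simpa using horthb 1 (by simp)
  obtain ⟨d, hd⟩ := exists_interpolatory_weights hc Ld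
  obtain ⟨b, hb⟩ := exists_interpolatory_weights hc Lb
  choose A hA using fun i => exists_interpolatory_weights hc (LA (c i))
  have hdiv : ∀ (p : ℝ[X]) (r : ℕ), p.natDegree ≤ s + r → (p /ₘ ω).natDegree ≤ r := by
    intro p r hp
    rw [natDegree_divByMonic p hmon, hωdeg]; omega
  have hdex : ∀ p : ℝ[X], p.natDegree ≤ s + 2 → ∑ j, d j * p.eval (c j) = Ld p := by
    intro p hp
    rw [hd, horth _ (hdiv p 2 hp), sub_zero]
  have LA_X : ∀ (x : ℝ) (k : ℕ), LA x (X ^ k) =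
      ((1 + x) ^ (k + 2) - 1) / (((k : ℝ) + 1) * (k + 2)) - x / (k + 1) := by
    intro x k
    rw [LA_apply, Lb_apply, Ld_apply, polyAntideriv_X_pow, polyAntideriv_polyAntideriv_X_pow,
      polyAntideriv_polyAntideriv_X_pow]
    simp only [one_pow]
    ring
  refine ⟨d, b, A, fun i => LA (c i) ω, ⟨fun k hk => ?_, fun k hk => ?_, fun i k hk => ?_,
    fun i => ?_, ?_⟩⟩
  · have := hdex (X ^ k) (by simp; omega)
    simpa [Ld_apply, polyAntideriv_X_pow] using this
  · have := hb (X ^ k)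
    rw [horthb _ (hdiv _ 1 (by simp; omega)), Lb_apply, polyAntideriv_polyAntideriv_X_pow] at this
    simpa using this
  · have := hA i (X ^ k)
    rw [(divByMonic_eq_zero_iff hmon).2 ?_, mul_zero, map_zero, sub_zero, LA_X] at this
    · simpa using this
    · rw [degree_X_pow, degree_eq_natDegree hmon.ne_zero, hωdeg]
      exact_mod_cast hk
  · have := hA i (X ^ s)
    have h1 : (X ^ s : ℝ[X]) /ₘ ω = 1 := by
      have h0 : ((X ^ s : ℝ[X]) /ₘ ω).natDegree = 0 := by
        rw [natDegree_divByMonic _ hmon, hωdeg]; simp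
      have hlc := leadingCoeff_divByMonic_of_monic (p := (X ^ s : ℝ[X])) hmon
        (by rw [degree_X_pow, degree_eq_natDegree hmon.ne_zero, hωdeg])
      rw [eq_C_of_natDegree_eq_zero h0]
      rw [leadingCoeff, h0] at hlc
      rw [hlc]; simp
    rw [h1, mul_one, LA_X] at this
    simp only [eval_pow, eval_X] at this
    rw [this]; ring
  · have hγ : ∀ x, LA x ω = (polyAntideriv (polyAntideriv ω)).eval (1 + x) := fun x => by
      rw [LA_apply, hLdω, hLbω]; ring
    have h1 := hdex ((polyAntideriv (polyAntideriv ω)).comp (1 + X)) (by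
      refine natDegree_comp_le.trans ?_
      have h2 := natDegree_polyAntideriv_le (polyAntideriv ω)
      have h3 := natDegree_polyAntideriv_le ω
      have h4 : (1 + X : ℝ[X]).natDegree = 1 := by rw [add_comm, ← C_1]; exact natDegree_X_add_C 1
      rw [h4]; omega)
    simp only [hγ]
    simp only [eval_comp, eval_add, eval_one, eval_X] at h1
    rw [h1, Ld_apply, ← integral_eval_eq_polyAntideriv]
    refine (intervalIntegral.integral_congr fun x _ => ?_).trans hS.1
    simp only [hωev, integral_eval_eq_polyAntideriv, eval_comp, eval_add, eval_one, eval_X]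

end Quadrature

/-! ### Uniform Taylor expansions on an interval -/

section Taylor

variable {E : Type*} [NormedAddCommGroup E] [NormedSpace ℝ E]

/-- The Taylor coefficient of order `k` at `t`, derivatives being taken within `I`. -/
noncomputable def taylorCoeff (I : Set ℝ) (g : ℝ → E) (k : ℕ) (t : ℝ) : E :=
  ((k.factorial : ℝ)⁻¹) • iteratedDerivWithin k g I t

theorem hasDerivWithinAt_sub_pow (I : Set ℝ) (t z : ℝ) (k : ℕ) :
    HasDerivWithinAt (fun x : ℝ => (x - t) ^ (k + 1)) (((k : ℝ) + 1) * (z - t) ^ k) I z := by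
  have h := ((hasDerivAt_id z).sub_const t).fun_pow (k + 1)
  simp only [id_eq, Nat.add_sub_cancel, mul_one, Nat.cast_add, Nat.cast_one] at h
  exact h.hasDerivWithinAt

theorem norm_sub_le_of_norm_deriv_le_pow {I : Set ℝ} (hI : Convex ℝ I) {ρ ρ' : ℝ → E}
    (hρ : ∀ x ∈ I, HasDerivWithinAt ρ (ρ' x) I x) {C : ℝ} (hC : 0 ≤ C) {N : ℕ} {t : ℝ}
    (ht : t ∈ I) (hb : ∀ x ∈ I, ‖ρ' x‖ ≤ C * |x - t| ^ N) {x : ℝ} (hx : x ∈ I) :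
    ‖ρ x - ρ t‖ ≤ C * |x - t| ^ (N + 1) := by
  have hsub : segment ℝ t x ⊆ I := hI.segment_subset ht hx
  have h := Convex.norm_image_sub_le_of_norm_hasDerivWithin_le (f := ρ) (f' := ρ')
    (s := segment ℝ t x) (C := C * |x - t| ^ N)
    (fun z hz => (hρ z (hsub hz)).mono hsub) (fun z hz => ?_) (convex_segment t x)
    (left_mem_segment ℝ t x) (right_mem_segment ℝ t x)
  · rwa [Real.norm_eq_abs, mul_assoc, ← pow_succ] at h
  · refine (hb z (hsub hz)).trans ?_
    gcongr C * ?_ ^ N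
    rw [segment_eq_uIcc] at hz
    exact abs_sub_left_of_mem_uIcc hz

theorem ContDiffOn.hasDerivWithinAt_iteratedDerivWithin {I : Set ℝ} (hI : UniqueDiffOn ℝ I)
    {g : ℝ → E} {N k : ℕ} (hg : ContDiffOn ℝ N g I) (hk : k < N) {x : ℝ} (hx : x ∈ I) :
    HasDerivWithinAt (iteratedDerivWithin k g I) (iteratedDerivWithin (k + 1) g I x) I x := by
  rw [iteratedDerivWithin_succ]
  exact ((hg.differentiableOn_iteratedDerivWithin (by exact_mod_cast hk) hI) x hx).hasDerivWithinAt

theorem iteratedDerivWithin_iteratedDerivWithin (I : Set ℝ) (g : ℝ → E) (j k : ℕ) :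
    iteratedDerivWithin k (iteratedDerivWithin j g I) I = iteratedDerivWithin (k + j) g I := by
  induction k with
  | zero => simp
  | succ k ih =>
    funext x
    rw [iteratedDerivWithin_succ, ih, Nat.add_right_comm, iteratedDerivWithin_succ]

theorem ContDiffOn.iteratedDerivWithin_nat {I : Set ℝ} (hI : UniqueDiffOn ℝ I) {g : ℝ → E}
    {N j : ℕ} (hg : ContDiffOn ℝ (N + j : ℕ) g I) :
    ContDiffOn ℝ N (iteratedDerivWithin j g I) I := by
  rw [contDiffOn_nat_iff_continuousOn_differentiableOn_deriv hI]
  refine ⟨fun k hk => ?_, fun k hk => ?_⟩ <;> rw [iteratedDerivWithin_iteratedDerivWithin]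
  · exact hg.continuousOn_iteratedDerivWithin (by exact_mod_cast (by omega)) hI
  · exact hg.differentiableOn_iteratedDerivWithin (by exact_mod_cast (by omega)) hI

theorem exists_norm_taylorCoeff_le {a b : ℝ} (hab : a < b) {g : ℝ → E} {N : ℕ}
    (hg : ContDiffOn ℝ N g (Icc a b)) :
    ∃ C, 0 ≤ C ∧ ∀ k ≤ N, ∀ t ∈ Icc a b, ‖taylorCoeff (Icc a b) g k t‖ ≤ C := by
  have h : ∀ k : ℕ, ∃ C, k ≤ N → ∀ t ∈ Icc a b, ‖taylorCoeff (Icc a b) g k t‖ ≤ C := by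
    intro k
    by_cases hk : k ≤ N
    · obtain ⟨C, hC⟩ := isCompact_Icc.exists_bound_of_continuousOn
        ((hg.continuousOn_iteratedDerivWithin (m := k) (by exact_mod_cast hk)
          (uniqueDiffOn_Icc hab)).const_smul ((k.factorial : ℝ)⁻¹))
      exact ⟨C, fun _ => hC⟩
    · exact ⟨0, fun h => absurd h hk⟩
  choose C hC using h
  refine ⟨∑ k ∈ Finset.range (N + 1), |C k|, by positivity, fun k hk t ht => ?_⟩
  exact (hC k hk t ht).trans ((le_abs_self _).trans (Finset.single_le_sum
    (f := fun k => |C k|) (fun _ _ => abs_nonneg _) (Finset.mem_range.2 (by omega))))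

/-- Taylor's formula on a compact interval with a remainder bound that is uniform in both points,
which may lie in either order. -/
theorem exists_norm_sub_taylor_le {a b : ℝ} (hab : a < b) (N : ℕ) {g : ℝ → E}
    (hg : ContDiffOn ℝ N g (Icc a b)) :
    ∃ C, 0 ≤ C ∧ ∀ t ∈ Icc a b, ∀ x ∈ Icc a b,
      ‖g x - ∑ k ∈ Finset.range N, (x - t) ^ k • taylorCoeff (Icc a b) g k t‖
        ≤ C * |x - t| ^ N := by
  have hU := uniqueDiffOn_Icc hab
  induction N generalizing g with
  | zero =>
    obtain ⟨C, hC0, hC⟩ := exists_norm_taylorCoeff_le hab hg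
    exact ⟨C, hC0, fun t _ x hx => by simpa [taylorCoeff] using hC 0 le_rfl x hx⟩
  | succ N ih =>
    have hg' : ContDiffOn ℝ N (iteratedDerivWithin 1 g (Icc a b)) (Icc a b) :=
      hg.iteratedDerivWithin_nat hU
    obtain ⟨C, hC0, hC⟩ := ih hg'
    refine ⟨C, hC0, fun t ht x hx => ?_⟩
    have key := norm_sub_le_of_norm_deriv_le_pow (convex_Icc a b)
      (ρ := fun x => g x - ∑ k ∈ Finset.range (N + 1),
        (x - t) ^ k • taylorCoeff (Icc a b) g k t) (fun z hz => ?_) hC0 ht (hC t ht) hx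
    · have h0 : ∑ k ∈ Finset.range (N + 1), (t - t) ^ k • taylorCoeff (Icc a b) g k t = g t := by
        rw [Finset.sum_range_succ']
        simp [taylorCoeff]
      rwa [h0, sub_self, sub_zero] at key
    · have h1 := hg.hasDerivWithinAt_iteratedDerivWithin hU (k := 0) (by omega) hz
      simp only [iteratedDerivWithin_zero, zero_add] at h1
      refine h1.sub ?_
      simp only [Finset.sum_range_succ', pow_zero, one_smul]
      refine HasDerivWithinAt.add_const _ ?_
      refine HasDerivWithinAt.fun_sum fun k _ => ?_
      convert (hasDerivWithinAt_sub_pow (Icc a b) t z k).smul_const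
        (taylorCoeff (Icc a b) g (k + 1) t) using 1
      simp only [taylorCoeff, iteratedDerivWithin_iteratedDerivWithin, smul_smul,
        Nat.factorial_succ]
      congr 1
      have : (k : ℝ) + 1 ≠ 0 := by positivity
      push_cast
      field_simp

/-- Integrated form of a Taylor-type expansion: a bound for the remainder of `g` gives bounds for
the remainders of `v` and `y` when `y' = v` and `v' = g`. -/
theorem norm_sub_integrated_taylor_le {I : Set ℝ} (hI : Convex ℝ I) {y v g : ℝ → E}
    (hy : ∀ x ∈ I, HasDerivWithinAt y (v x) I x) (hv : ∀ x ∈ I, HasDerivWithinAt v (g x) I x)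
    {N : ℕ} {G : ℕ → E} {C t : ℝ} (hC0 : 0 ≤ C) (ht : t ∈ I)
    (hG : ∀ x ∈ I, ‖g x - ∑ k ∈ Finset.range N, (x - t) ^ k • G k‖ ≤ C * |x - t| ^ N)
    {x : ℝ} (hx : x ∈ I) :
    ‖v x - v t - ∑ k ∈ Finset.range N, ((x - t) ^ (k + 1) / ((k : ℝ) + 1)) • G k‖
        ≤ C * |x - t| ^ (N + 1) ∧
    ‖y x - y t - (x - t) • v t
        - ∑ k ∈ Finset.range N, ((x - t) ^ (k + 2) / (((k : ℝ) + 1) * (k + 2))) • G k‖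
        ≤ C * |x - t| ^ (N + 2) := by
  have hv' : ∀ x ∈ I, ‖v x - v t - ∑ k ∈ Finset.range N, ((x - t) ^ (k + 1) / ((k : ℝ) + 1)) • G k‖
        ≤ C * |x - t| ^ (N + 1) := by
    intro x hx
    have key := norm_sub_le_of_norm_deriv_le_pow hI
      (ρ := fun x => v x - v t - ∑ k ∈ Finset.range N, ((x - t) ^ (k + 1) / ((k : ℝ) + 1)) • G k)
      (fun z hz => ?_) hC0 ht hG hx
    · simpa using key
    · refine ((hv z hz).sub_const _).sub (HasDerivWithinAt.fun_sum fun k _ => ?_)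
      refine HasDerivWithinAt.smul_const ?_ _
      convert (hasDerivWithinAt_sub_pow I t z k).div_const ((k : ℝ) + 1) using 1
      have : (k : ℝ) + 1 ≠ 0 := by positivity
      field_simp
  refine ⟨hv' x hx, ?_⟩
  have key := norm_sub_le_of_norm_deriv_le_pow hI
    (ρ := fun x => y x - y t - (x - t) • v t
      - ∑ k ∈ Finset.range N, ((x - t) ^ (k + 2) / (((k : ℝ) + 1) * (k + 2))) • G k)
    (fun z hz => ?_) hC0 ht hv' hx
  · simpa using key
  · refine HasDerivWithinAt.sub (HasDerivWithinAt.sub ((hy z hz).sub_const _) ?_)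
      (HasDerivWithinAt.fun_sum fun k _ => ?_)
    · simpa using ((hasDerivWithinAt_id z I).sub_const t).smul_const (v t)
    · refine HasDerivWithinAt.smul_const ?_ _
      convert (hasDerivWithinAt_sub_pow I t z (k + 1)).div_const (((k : ℝ) + 1) * (k + 2)) using 1
      have h3 : (k : ℝ) + 1 ≠ 0 := by positivity
      have h4 : (k : ℝ) + 2 ≠ 0 := by positivity
      push_cast
      field_simp
      ring

end Taylor

/-! ### Local bases and functionals supported on the nodes -/

section LocalBasis

variable {E : Type*} [NormedAddCommGroup E] [NormedSpace ℝ E] {s : ℕ}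

/-- If the Wronskian of `φ` has no zero, the span of `φ` contains, near every `t` and up to
`O(|x - t| ^ s)`, each of the monomials `(x - t) ^ k` with `k < s`. The coefficients `B t` form the
inverse of the matrix of Taylor coefficients and are therefore bounded. -/
theorem exists_local_monomials {a b : ℝ} (hab : a < b) {φ : Fin s → ℝ → ℝ}
    (hφ : ∀ i, ContDiffOn ℝ s (φ i) (Icc a b))
    (hW : ∀ t ∈ Icc a b,
      (Matrix.of fun k i : Fin s => iteratedDerivWithin (k : ℕ) (φ i) (Icc a b) t).det ≠ 0) :
    ∃ (B : ℝ → Fin s → Fin s → ℝ) (C : ℝ), 0 ≤ C ∧ ∀ t ∈ Icc a b, (∀ i k, |B t i k| ≤ C) ∧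
      ∀ x ∈ Icc a b, ∀ k : Fin s,
        |(x - t) ^ (k : ℕ) - ∑ i, φ i x * B t i k| ≤ C * |x - t| ^ s := by
  let W : ℝ → Matrix (Fin s) (Fin s) ℝ := fun t =>
    Matrix.of fun k i => taylorCoeff (Icc a b) (φ i) (k : ℕ) t
  have hdet : ∀ t ∈ Icc a b, (W t).det ≠ 0 := by
    intro t ht
    have : W t = Matrix.of fun k i : Fin s => (((k : ℕ).factorial : ℝ)⁻¹) *
        (Matrix.of fun k i : Fin s => iteratedDerivWithin (k : ℕ) (φ i) (Icc a b) t) k i := rfl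
    rw [this, Matrix.det_mul_column]
    exact mul_ne_zero (Finset.prod_ne_zero_iff.2 fun k _ => by positivity) (hW t ht)
  have hWcont : Continuous fun t : Icc a b => W t := by
    refine continuous_matrix fun k i => ?_
    have h := (hφ i).continuousOn_iteratedDerivWithin (m := (k : ℕ))
      (by exact_mod_cast k.2.le) (uniqueDiffOn_Icc hab)
    exact (continuousOn_iff_continuous_domRestrict.1 h).const_smul _
  have hBcont : Continuous fun t : Icc a b => fun i k : Fin s => (W t)⁻¹ i k := by
    have h : Continuous fun t : Icc a b => (W t)⁻¹ := by
      simp only [Matrix.inv_def, Ring.inverse_eq_inv']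
      exact (hWcont.matrix_det.inv₀ fun t => hdet t t.2).smul hWcont.matrix_adjugate
    exact continuous_pi fun i => continuous_pi fun k => h.matrix_elem i k
  obtain ⟨C₁, hC₁⟩ := isCompact_univ.exists_bound_of_continuousOn hBcont.continuousOn
  have hB : ∀ t ∈ Icc a b, ∀ i k, |(W t)⁻¹ i k| ≤ max C₁ 0 := fun t ht i k =>
    ((norm_le_pi_norm (fun k => (W t)⁻¹ i k) k).trans
      (norm_le_pi_norm (fun i k => (W t)⁻¹ i k) i)).trans
      ((hC₁ ⟨t, ht⟩ (mem_univ _)).trans (le_max_left _ _))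
  choose C₂ hC₂0 hC₂ using fun i => exists_norm_sub_taylor_le hab s (hφ i)
  refine ⟨fun t i k => (W t)⁻¹ i k, max C₁ 0 + ∑ i, C₂ i * max C₁ 0, ?_, fun t ht => ⟨?_, ?_⟩⟩
  · exact add_nonneg (le_max_right _ _)
      (Finset.sum_nonneg fun i _ => mul_nonneg (hC₂0 i) (le_max_right _ _))
  · intro i k
    refine (hB t ht i k).trans (le_add_of_nonneg_right ?_)
    exact Finset.sum_nonneg fun i _ => mul_nonneg (hC₂0 i) (le_max_right _ _)
  · intro x hx k
    let ρ : Fin s → ℝ := fun i =>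
      φ i x - ∑ l ∈ Finset.range s, (x - t) ^ l • taylorCoeff (Icc a b) (φ i) l t
    have hinv : W t * (W t)⁻¹ = 1 :=
      Matrix.mul_nonsing_inv _ (isUnit_iff_ne_zero.2 (hdet t ht))
    have h1 : ∑ i, (∑ l : Fin s, (x - t) ^ (l : ℕ) * W t l i) * (W t)⁻¹ i k
        = (x - t) ^ (k : ℕ) := by
      simp only [Finset.sum_mul]
      rw [Finset.sum_comm]
      simp only [mul_assoc, ← Finset.mul_sum]
      have h2 : ∀ l, ∑ i, W t l i * (W t)⁻¹ i k = if l = k then 1 else 0 := fun l => by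
        rw [← Matrix.mul_apply, hinv, Matrix.one_apply]
      simp [h2]
    have h3 : (x - t) ^ (k : ℕ) - ∑ i, φ i x * (W t)⁻¹ i k = - ∑ i, ρ i * (W t)⁻¹ i k := by
      rw [← h1, ← Finset.sum_sub_distrib, ← Finset.sum_neg_distrib]
      refine Finset.sum_congr rfl fun i _ => ?_
      simp only [ρ, W, Matrix.of_apply, smul_eq_mul, Finset.sum_range]
      ring
    rw [h3, abs_neg]
    refine (Finset.abs_sum_le_sum_abs _ _).trans ?_
    rw [add_mul, Finset.sum_mul]
    refine le_trans (Finset.sum_le_sum fun i _ => ?_)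
      (le_add_of_nonneg_left (by positivity))
    rw [abs_mul, mul_right_comm]
    exact mul_le_mul (hC₂ i t ht x hx) (hB t ht i k) (abs_nonneg _)
      (mul_nonneg (hC₂0 i) (by positivity))

/-- Every function of class `C^s` agrees, near every `t` and up to `O(|x - t| ^ s)`, with an element
of the span of `φ` whose coefficients are bounded uniformly in `t`. -/
theorem exists_local_approximation {a b : ℝ} (hab : a < b) {φ : Fin s → ℝ → ℝ}
    (hφ : ∀ i, ContDiffOn ℝ s (φ i) (Icc a b))
    (hW : ∀ t ∈ Icc a b,
      (Matrix.of fun k i : Fin s => iteratedDerivWithin (k : ℕ) (φ i) (Icc a b) t).det ≠ 0)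
    {g : ℝ → E} (hg : ContDiffOn ℝ s g (Icc a b)) :
    ∃ (α : ℝ → Fin s → E) (C : ℝ), 0 ≤ C ∧ ∀ t ∈ Icc a b, (∀ i, ‖α t i‖ ≤ C) ∧
      ∀ x ∈ Icc a b, ‖g x - ∑ i, φ i x • α t i‖ ≤ C * |x - t| ^ s := by
  obtain ⟨B, C₁, hC₁, hB⟩ := exists_local_monomials hab hφ hW
  obtain ⟨C₂, hC₂, hG⟩ := exists_norm_taylorCoeff_le hab hg
  obtain ⟨C₃, hC₃, hT⟩ := exists_norm_sub_taylor_le hab s hg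
  let G : ℝ → Fin s → E := fun t k => taylorCoeff (Icc a b) g k t
  have hG' : ∀ t ∈ Icc a b, ∀ k : Fin s, ‖G t k‖ ≤ C₂ := fun t ht k => hG k k.2.le t ht
  refine ⟨fun t i => ∑ k, B t i k • G t k, s * (C₁ * C₂) + C₃, by positivity,
    fun t ht => ⟨fun i => ?_, fun x hx => ?_⟩⟩
  · refine (norm_sum_le_of_le (n := fun _ => C₁ * C₂) _ fun k _ => ?_).trans ?_
    · rw [norm_smul]
      exact mul_le_mul ((hB t ht).1 i k) (hG' t ht k) (norm_nonneg _) hC₁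
    · simpa using hC₃
  · have h1 : g x - ∑ i, φ i x • ∑ k, B t i k • G t k =
        ∑ k : Fin s, ((x - t) ^ (k : ℕ) - ∑ i, φ i x * B t i k) • G t k
          + (g x - ∑ k ∈ Finset.range s, (x - t) ^ k • taylorCoeff (Icc a b) g k t) := by
      have h2 : ∑ i, φ i x • ∑ k, B t i k • G t k = ∑ k, (∑ i, φ i x * B t i k) • G t k := by
        simp only [Finset.smul_sum, Finset.sum_smul, smul_smul]
        exact Finset.sum_comm
      rw [h2, Finset.sum_range]
      simp only [sub_smul, Finset.sum_sub_distrib]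
      simp only [G]
      abel
    rw [h1, add_mul]
    refine (norm_add_le _ _).trans (add_le_add ?_ (hT t ht x hx))
    refine (norm_sum_le_of_le (n := fun _ => C₁ * |x - t| ^ s * C₂) _ fun k _ => ?_).trans ?_
    · rw [norm_smul]
      exact mul_le_mul ((hB t ht).2 x hx k) (hG' t ht k) (norm_nonneg _) (by positivity)
    · simp only [Finset.sum_const, Finset.card_univ, Fintype.card_fin, nsmul_eq_mul]
      exact le_of_eq (by ring)

theorem sum_abs_mul_pow_le (c D : Fin s → ℝ) {C h : ℝ} (hC : 0 ≤ C) (hh : 0 ≤ h) (t : ℝ) (N : ℕ) :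
    ∑ j, |D j| * (C * |t + c j * h - t| ^ N) ≤ s * (C * ‖c‖ ^ N) * (h ^ N * ‖D‖) := by
  have : ∀ j ∈ Finset.univ, |D j| * (C * |t + c j * h - t| ^ N) ≤ ‖D‖ * (C * (‖c‖ * h) ^ N) := by
    intro j _
    have h1 : |D j| ≤ ‖D‖ := norm_le_pi_norm D j
    have h2 : |c j| ≤ ‖c‖ := norm_le_pi_norm c j
    rw [add_sub_cancel_left, abs_mul, abs_of_nonneg hh]
    gcongr
  refine (Finset.sum_le_sum this).trans (le_of_eq ?_)
  rw [Finset.sum_const, Finset.card_univ, Fintype.card_fin, nsmul_eq_mul, mul_pow]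
  ring

/-- The weights `D` of a functional supported on the nodes `t + c_j h` are controlled by its values
on `φ`. Applied to the local monomials, these values bound the scaled moments
`h ^ k * ∑ j, D j * c j ^ k`, and the Vandermonde matrix of `c` recovers `D` from the moments. -/
theorem exists_norm_weights_le {a b : ℝ} (hab : a < b) {φ : Fin s → ℝ → ℝ}
    (hφ : ∀ i, ContDiffOn ℝ s (φ i) (Icc a b))
    (hW : ∀ t ∈ Icc a b,
      (Matrix.of fun k i : Fin s => iteratedDerivWithin (k : ℕ) (φ i) (Icc a b) t).det ≠ 0)
    {c : Fin s → ℝ} (hc : Function.Injective c) :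
    ∃ C h₀ : ℝ, 0 ≤ C ∧ 0 < h₀ ∧ h₀ ≤ 1 ∧ ∀ t ∈ Icc a b, ∀ h : ℝ, 0 < h → h ≤ h₀ →
      (∀ j, t + c j * h ∈ Icc a b) → ∀ D : Fin s → ℝ,
        h ^ s * ‖D‖ ≤ C * h * ‖fun i => ∑ j, D j * φ i (t + c j * h)‖ := by
  obtain ⟨B, C₁, hC₁, hB⟩ := exists_local_monomials hab hφ hW
  let V := Matrix.vandermonde c
  have hV : V * V⁻¹ = 1 := Matrix.mul_nonsing_inv _
    (isUnit_iff_ne_zero.2 (Matrix.det_vandermonde_ne_zero_iff.2 hc))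
  let CV : ℝ := ∑ k, ∑ l, |V⁻¹ k l|
  have hCV : 0 ≤ CV := by positivity
  let C₂ : ℝ := s * (C₁ * ‖c‖ ^ s)
  have hC₂ : 0 ≤ C₂ := by positivity
  refine ⟨2 * (CV * (s * C₁)), min 1 (1 / (2 * (CV * C₂ + 1))), by positivity, by positivity,
    min_le_left _ _, fun t ht h hh hh0 hnode D => ?_⟩
  have hh1 : h ≤ 1 := hh0.trans (min_le_left _ _)
  have hsmall : CV * C₂ * h ≤ 1 / 2 := by
    have h1 : h ≤ 1 / (2 * (CV * C₂ + 1)) := hh0.trans (min_le_right _ _)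
    rw [le_div_iff₀ (by positivity)] at h1
    nlinarith
  set z : Fin s → ℝ := fun i => ∑ j, D j * φ i (t + c j * h) with hz
  let m : Fin s → ℝ := fun k => ∑ j, D j * c j ^ (k : ℕ)
  have hm : ∀ k : Fin s, h ^ (k : ℕ) * |m k| ≤ s * C₁ * ‖z‖ + C₂ * (h ^ s * ‖D‖) := by
    intro k
    have h1 : h ^ (k : ℕ) * m k = ∑ i, z i * B t i k + ∑ j, D j *
        ((t + c j * h - t) ^ (k : ℕ) - ∑ i, φ i (t + c j * h) * B t i k) := by
      have h2 : ∑ i, z i * B t i k = ∑ j, D j * ∑ i, φ i (t + c j * h) * B t i k := by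
        simp only [hz, Finset.sum_mul, Finset.mul_sum]
        rw [Finset.sum_comm]
        simp only [mul_assoc]
      rw [h2, ← Finset.sum_add_distrib, Finset.mul_sum]
      refine Finset.sum_congr rfl fun j _ => ?_
      rw [add_sub_cancel_left, mul_pow]
      ring
    rw [← abs_of_nonneg (pow_nonneg hh.le (k : ℕ)), ← abs_mul, h1]
    refine (abs_add_le _ _).trans (add_le_add ?_ ?_)
    · refine (Finset.abs_sum_le_sum_abs _ _).trans
        ((Finset.sum_le_sum (g := fun _ => ‖z‖ * C₁) fun i _ => ?_).trans ?_)
      · rw [abs_mul]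
        exact mul_le_mul (norm_le_pi_norm z i) ((hB t ht).1 i k) (abs_nonneg _) (norm_nonneg _)
      · rw [Finset.sum_const, Finset.card_univ, Fintype.card_fin, nsmul_eq_mul]
        exact le_of_eq (by ring)
    · refine (Finset.abs_sum_le_sum_abs _ _).trans
        (le_trans (Finset.sum_le_sum fun j _ => ?_) (sum_abs_mul_pow_le c D hC₁ hh.le t s))
      rw [abs_mul]
      exact mul_le_mul_of_nonneg_left ((hB t ht).2 _ (hnode j) k) (abs_nonneg _)
  set Q := s * C₁ * ‖z‖ + C₂ * (h ^ s * ‖D‖) with hQ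
  have hQ0 : 0 ≤ Q := by positivity
  have hm' : ∀ k : Fin s, h ^ s * |m k| ≤ h * Q := by
    intro k
    have h1 : h ^ s = h * (h ^ (s - 1 - k) * h ^ (k : ℕ)) := by
      rw [← pow_add, ← pow_succ']; congr 1; omega
    have h2 : h ^ (s - 1 - (k : ℕ)) ≤ 1 := pow_le_one₀ hh.le hh1
    calc h ^ s * |m k| = h * (h ^ (s - 1 - (k : ℕ)) * (h ^ (k : ℕ) * |m k|)) := by
          rw [h1]; ring
      _ ≤ h * (1 * Q) := by
          gcongr
          exact hm k
      _ = h * Q := by ring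
  have hD : h ^ s * ‖D‖ ≤ CV * (h * Q) := by
    have h1 : ∀ l, D l = ∑ k, m k * V⁻¹ k l := by
      intro l
      have h2 : Matrix.vecMul (Matrix.vecMul D V) V⁻¹ = D := by
        rw [Matrix.vecMul_vecMul, hV, Matrix.vecMul_one]
      exact (congrFun h2 l).symm
    rw [← abs_of_nonneg (pow_nonneg hh.le s), ← Real.norm_eq_abs, ← norm_smul,
      pi_norm_le_iff_of_nonneg (by positivity)]
    intro l
    rw [Pi.smul_apply, smul_eq_mul, Real.norm_eq_abs, abs_mul, abs_of_nonneg (pow_nonneg hh.le s),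
      h1 l]
    calc h ^ s * |∑ k, m k * V⁻¹ k l| ≤ h ^ s * ∑ k, |m k * V⁻¹ k l| := by
          gcongr; exact Finset.abs_sum_le_sum_abs _ _
      _ = ∑ k, (h ^ s * |m k|) * |V⁻¹ k l| := by
          rw [Finset.mul_sum]; simp only [abs_mul, mul_assoc]
      _ ≤ ∑ k, (h * Q) * ∑ l, |V⁻¹ k l| := by
          refine Finset.sum_le_sum fun k _ => mul_le_mul (hm' k) ?_ (abs_nonneg _) (by positivity)
          exact Finset.single_le_sum (f := fun l => |V⁻¹ k l|)
            (fun _ _ => abs_nonneg _) (Finset.mem_univ l)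
      _ = CV * (h * Q) := by rw [← Finset.mul_sum, mul_comm]
  have hX : 0 ≤ h ^ s * ‖D‖ := by positivity
  have h5 : CV * (h * Q) = CV * (s * C₁) * h * ‖z‖ + CV * C₂ * h * (h ^ s * ‖D‖) := by
    rw [hQ]; ring
  nlinarith [mul_le_mul_of_nonneg_right hsmall hX]

theorem norm_sum_smul_sub_le {a b : ℝ} {φ : Fin s → ℝ → ℝ} {g : ℝ → E} {α : Fin s → E}
    {c : Fin s → ℝ} {C t h : ℝ} (hC : 0 ≤ C) (hh : 0 ≤ h)
    (hα : ∀ x ∈ Icc a b, ‖g x - ∑ i, φ i x • α i‖ ≤ C * |x - t| ^ s)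
    (hnode : ∀ j, t + c j * h ∈ Icc a b) (D : Fin s → ℝ) :
    ‖∑ j, D j • g (t + c j * h) - ∑ i, (∑ j, D j * φ i (t + c j * h)) • α i‖
      ≤ s * (C * ‖c‖ ^ s) * (h ^ s * ‖D‖) := by
  have h1 : ∑ j, D j • g (t + c j * h) - ∑ i, (∑ j, D j * φ i (t + c j * h)) • α i =
      ∑ j, D j • (g (t + c j * h) - ∑ i, φ i (t + c j * h) • α i) := by
    simp only [smul_sub, Finset.sum_sub_distrib, Finset.smul_sum, Finset.sum_smul, smul_smul]
    rw [Finset.sum_comm]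
  rw [h1]
  refine le_trans (norm_sum_le_of_le _ fun j _ => ?_) (sum_abs_mul_pow_le c D hC hh t s)
  rw [norm_smul, Real.norm_eq_abs]
  exact mul_le_mul_of_nonneg_left (hα _ (hnode j)) (abs_nonneg _)

end LocalBasis

/-! ### Residuals of the method on smooth functions -/

section Residuals

variable {E : Type*} [NormedAddCommGroup E] [NormedSpace ℝ E] {s : ℕ}

theorem norm_quadrature_sub_le {a b : ℝ} {g : ℝ → E} {G : ℕ → E} {c w : Fin s → ℝ} {μ : ℕ → ℝ}
    {N : ℕ} {C t h : ℝ} (hC : 0 ≤ C) (hh : 0 ≤ h)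
    (hG : ∀ x ∈ Icc a b, ‖g x - ∑ k ∈ Finset.range N, (x - t) ^ k • G k‖ ≤ C * |x - t| ^ N)
    (hμ : ∀ k < N, ∑ j, w j * c j ^ k = μ k) (hnode : ∀ j, t + c j * h ∈ Icc a b) :
    ‖∑ j, w j • g (t + c j * h) - ∑ k ∈ Finset.range N, (h ^ k * μ k) • G k‖
      ≤ s * (C * ‖c‖ ^ N) * (h ^ N * ‖w‖) := by
  have h1 : ∑ k ∈ Finset.range N, (h ^ k * μ k) • G k =
      ∑ j, w j • ∑ k ∈ Finset.range N, (t + c j * h - t) ^ k • G k := by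
    simp only [Finset.smul_sum, smul_smul]
    rw [Finset.sum_comm]
    refine Finset.sum_congr rfl fun k hk => ?_
    rw [← hμ k (Finset.mem_range.1 hk), Finset.mul_sum, Finset.sum_smul]
    refine Finset.sum_congr rfl fun j _ => ?_
    rw [add_sub_cancel_left, mul_pow]
    congr 1
    ring
  rw [h1, ← Finset.sum_sub_distrib]
  simp only [← smul_sub]
  refine le_trans (norm_sum_le_of_le _ fun j _ => ?_) (sum_abs_mul_pow_le c w hC hh t N)
  rw [norm_smul, Real.norm_eq_abs]
  exact mul_le_mul_of_nonneg_left (hG _ (hnode j)) (abs_nonneg _)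

/-- Residuals of the classical weights on a smooth triple `y, v = y', g = y''`. The leading term of
the residual of the `i`-th stage is a vector that does not depend on `i`, multiplied by `γ i`. -/
theorem IsClassicalWeights.exists_residual_le {c dw bw : Fin s → ℝ} {A : Fin s → Fin s → ℝ}
    {γ : Fin s → ℝ} (hw : IsClassicalWeights c dw bw A γ) {a b : ℝ} (hab : a < b) {y v g : ℝ → E}
    (hg : ContDiffOn ℝ (s + 3 : ℕ) g (Icc a b))
    (hy : ∀ x ∈ Icc a b, HasDerivWithinAt y (v x) (Icc a b) x)
    (hv : ∀ x ∈ Icc a b, HasDerivWithinAt v (g x) (Icc a b) x) :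
    ∃ C, 0 ≤ C ∧ ∀ t ∈ Icc a b, ∀ h : ℝ, 0 < h → t + h ∈ Icc a b →
      (∀ j, t + c j * h ∈ Icc a b) →
      ‖v (t + h) - v t - h • ∑ j, dw j • g (t + c j * h)‖ ≤ C * h ^ (s + 4) ∧
      ‖y (t + h) - y t - h • v t - h ^ 2 • ∑ j, bw j • g (t + c j * h)‖ ≤ C * h ^ (s + 4) ∧
      ∀ i, t + h + c i * h ∈ Icc a b →
        ‖y (t + h + c i * h) - y (t + h) - (h * c i) • v (t + h)
          - h ^ 2 • ∑ j, A i j • g (t + c j * h)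
          - (h ^ (s + 2) * γ i) • taylorCoeff (Icc a b) g s t‖ ≤ C * h ^ (s + 3) := by
  obtain ⟨C₃, hC₃, hT₃⟩ := exists_norm_sub_taylor_le hab (s + 3) hg
  obtain ⟨C₂, hC₂, hT₂⟩ := exists_norm_sub_taylor_le hab (s + 2)
    (hg.of_le (by exact_mod_cast (by omega)))
  obtain ⟨C₁, hC₁, hT₁⟩ := exists_norm_sub_taylor_le hab (s + 1)
    (hg.of_le (by exact_mod_cast (by omega)))
  have hI : Convex ℝ (Icc a b) := convex_Icc a b
  let Kd := C₃ + s * (C₃ * ‖c‖ ^ (s + 3)) * ‖dw‖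
  let Kb := C₂ + s * (C₂ * ‖c‖ ^ (s + 2)) * ‖bw‖
  let KA := C₁ * (1 + ‖c‖) ^ (s + 3) + C₁ + ‖c‖ * C₁ + s * (C₁ * ‖c‖ ^ (s + 1)) * ‖A‖
  have hKd : 0 ≤ Kd := by positivity
  have hKb : 0 ≤ Kb := by positivity
  have hKA : 0 ≤ KA := by positivity
  refine ⟨Kd + Kb + KA, by positivity, fun t ht h hh hth hnode => ⟨?_, ?_, fun i hi => ?_⟩⟩
  · have h1 := (norm_sub_integrated_taylor_le hI hy hv hC₃ ht (hT₃ t ht) hth).1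
    have h2 := norm_quadrature_sub_le hC₃ hh.le (hT₃ t ht) hw.d_moment hnode
    simp only [add_sub_cancel_left, abs_of_pos hh] at h1
    set G : ℕ → E := fun k => taylorCoeff (Icc a b) g k t
    have h3 : v (t + h) - v t - h • ∑ j, dw j • g (t + c j * h) =
        (v (t + h) - v t - ∑ k ∈ Finset.range (s + 3), (h ^ (k + 1) / ((k : ℝ) + 1)) • G k)
        - h • (∑ j, dw j • g (t + c j * h)
          - ∑ k ∈ Finset.range (s + 3), (h ^ k * (1 / ((k : ℝ) + 1))) • G k) := by
      have h4 : ∑ k ∈ Finset.range (s + 3), (h ^ (k + 1) / ((k : ℝ) + 1)) • G k =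
          h • ∑ k ∈ Finset.range (s + 3), (h ^ k * (1 / ((k : ℝ) + 1))) • G k := by
        rw [Finset.smul_sum]
        refine Finset.sum_congr rfl fun k _ => ?_
        rw [smul_smul]; congr 1; ring
      rw [h4, smul_sub]; abel
    rw [h3]
    calc _ ≤ C₃ * h ^ (s + 3 + 1) + h * (s * (C₃ * ‖c‖ ^ (s + 3)) * (h ^ (s + 3) * ‖dw‖)) := by
          refine (norm_sub_le _ _).trans (add_le_add h1 ?_)
          rw [norm_smul, Real.norm_eq_abs, abs_of_pos hh]
          exact mul_le_mul_of_nonneg_left h2 hh.le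
      _ = Kd * h ^ (s + 4) := by simp only [Kd]; ring
      _ ≤ _ := by gcongr; linarith
  · have h1 := (norm_sub_integrated_taylor_le hI hy hv hC₂ ht (hT₂ t ht) hth).2
    have h2 := norm_quadrature_sub_le hC₂ hh.le (hT₂ t ht) hw.b_moment hnode
    simp only [add_sub_cancel_left, abs_of_pos hh] at h1
    set G : ℕ → E := fun k => taylorCoeff (Icc a b) g k t
    have h3 : y (t + h) - y t - h • v t - h ^ 2 • ∑ j, bw j • g (t + c j * h) =
        (y (t + h) - y t - h • v t
          - ∑ k ∈ Finset.range (s + 2), (h ^ (k + 2) / (((k : ℝ) + 1) * (k + 2))) • G k)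
        - h ^ 2 • (∑ j, bw j • g (t + c j * h)
          - ∑ k ∈ Finset.range (s + 2), (h ^ k * (1 / (((k : ℝ) + 1) * (k + 2)))) • G k) := by
      have h4 : ∑ k ∈ Finset.range (s + 2), (h ^ (k + 2) / (((k : ℝ) + 1) * (k + 2))) • G k =
          h ^ 2 • ∑ k ∈ Finset.range (s + 2), (h ^ k * (1 / (((k : ℝ) + 1) * (k + 2)))) • G k := by
        rw [Finset.smul_sum]
        refine Finset.sum_congr rfl fun k _ => ?_
        rw [smul_smul]; congr 1; ring
      rw [h4, smul_sub]; abel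
    rw [h3]
    calc _ ≤ C₂ * h ^ (s + 2 + 2)
          + h ^ 2 * (s * (C₂ * ‖c‖ ^ (s + 2)) * (h ^ (s + 2) * ‖bw‖)) := by
          refine (norm_sub_le _ _).trans (add_le_add h1 ?_)
          rw [norm_smul, Real.norm_eq_abs, abs_of_pos (by positivity : 0 < h ^ 2)]
          exact mul_le_mul_of_nonneg_left h2 (by positivity)
      _ = Kb * h ^ (s + 4) := by simp only [Kb]; ring
      _ ≤ _ := by gcongr; linarith
  · set G : ℕ → E := fun k => taylorCoeff (Icc a b) g k t
    let μ : ℕ → ℝ := fun k => ((1 + c i) ^ (k + 2) - 1) / (((k : ℝ) + 1) * (k + 2))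
      - c i / (k + 1) - if k = s then γ i else 0
    have hμ : ∀ k < s + 1, ∑ j, A i j * c j ^ k = μ k := by
      intro k hk
      rcases Nat.lt_succ_iff_lt_or_eq.1 hk with hk | rfl
      · simp [μ, hk.ne, hw.A_moment i k hk]
      · simp [μ, ← hw.A_defect i]
    have h1 := norm_sub_integrated_taylor_le hI hy hv hC₁ ht (hT₁ t ht) hth
    have h1' := (norm_sub_integrated_taylor_le hI hy hv hC₁ ht (hT₁ t ht) hi).2
    have h2 := norm_quadrature_sub_le hC₁ hh.le (hT₁ t ht) hμ hnode
    have e1 : t + h + c i * h - t = (1 + c i) * h := by ring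
    simp only [add_sub_cancel_left, abs_of_pos hh] at h1
    simp only [e1] at h1'
    have hci : |c i| ≤ ‖c‖ := norm_le_pi_norm c i
    have hAi : ‖A i‖ ≤ ‖A‖ := norm_le_pi_norm A i
    have h3 : y (t + h + c i * h) - y (t + h) - (h * c i) • v (t + h)
          - h ^ 2 • ∑ j, A i j • g (t + c j * h) - (h ^ (s + 2) * γ i) • G s =
        (y (t + h + c i * h) - y t - ((1 + c i) * h) • v t
          - ∑ k ∈ Finset.range (s + 1),
              (((1 + c i) * h) ^ (k + 2) / (((k : ℝ) + 1) * (k + 2))) • G k)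
        - (y (t + h) - y t - h • v t
          - ∑ k ∈ Finset.range (s + 1), (h ^ (k + 2) / (((k : ℝ) + 1) * (k + 2))) • G k)
        - (h * c i) • (v (t + h) - v t
          - ∑ k ∈ Finset.range (s + 1), (h ^ (k + 1) / ((k : ℝ) + 1)) • G k)
        - h ^ 2 • (∑ j, A i j • g (t + c j * h)
          - ∑ k ∈ Finset.range (s + 1), (h ^ k * μ k) • G k) := by
      have h4 : ∑ k ∈ Finset.range (s + 1),
            (((1 + c i) * h) ^ (k + 2) / (((k : ℝ) + 1) * (k + 2))) • G k =
          ∑ k ∈ Finset.range (s + 1), (h ^ (k + 2) / (((k : ℝ) + 1) * (k + 2))) • G k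
          + (h * c i) • ∑ k ∈ Finset.range (s + 1), (h ^ (k + 1) / ((k : ℝ) + 1)) • G k
          + h ^ 2 • ∑ k ∈ Finset.range (s + 1), (h ^ k * μ k) • G k
          + (h ^ (s + 2) * γ i) • G s := by
        have h5 : (h ^ (s + 2) * γ i) • G s = ∑ k ∈ Finset.range (s + 1),
            (h ^ (k + 2) * if k = s then γ i else 0) • G k := by
          rw [Finset.sum_eq_single_of_mem s (by simp) (fun k _ hk => by simp [hk])]
          simp
        rw [h5]
        simp only [Finset.smul_sum, smul_smul, ← Finset.sum_add_distrib, ← add_smul]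
        refine Finset.sum_congr rfl fun k _ => ?_
        congr 1
        simp only [μ, mul_pow]
        ring
      have h6 : ((1 + c i) * h) • v t = h • v t + (h * c i) • v t := by
        rw [← add_smul]; congr 1; ring
      rw [h4, h6]
      simp only [smul_sub]
      abel
    rw [h3]
    have h7 : |(1 + c i) * h| ≤ (1 + ‖c‖) * h := by
      rw [abs_mul, abs_of_pos hh]
      gcongr
      exact (abs_add_le _ _).trans (by rw [abs_one]; gcongr)
    calc _ ≤ C₁ * ((1 + ‖c‖) * h) ^ (s + 1 + 2) + C₁ * h ^ (s + 1 + 2)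
          + (h * ‖c‖) * (C₁ * h ^ (s + 1 + 1))
          + h ^ 2 * (s * (C₁ * ‖c‖ ^ (s + 1)) * (h ^ (s + 1) * ‖A‖)) := by
          refine (norm_sub_le _ _).trans (add_le_add ((norm_sub_le _ _).trans (add_le_add
            ((norm_sub_le _ _).trans (add_le_add (h1'.trans ?_) h1.2)) ?_)) ?_)
          · gcongr
          · rw [norm_smul, Real.norm_eq_abs, abs_mul, abs_of_pos hh]
            gcongr
            exact h1.1
          · rw [norm_smul, Real.norm_eq_abs, abs_of_pos (by positivity : 0 < h ^ 2)]
            refine mul_le_mul_of_nonneg_left (h2.trans ?_) (by positivity)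
            gcongr
      _ = KA * h ^ (s + 3) := by simp only [KA, mul_pow]; ring
      _ ≤ _ := by gcongr; linarith

/-- Passage from known weights `w₀` to weights `w` that are exact on the functions `φ i`. If `X i`
and `Xy` are the quantities that `h ^ r * ∑ j, w j * φ i (ξ j)` and `h ^ r • ∑ j, w j • g (ξ j)`
are to approximate, then smallness of the residuals of `w₀` carries over to `w`, because
`z i = ∑ j, (w j - w₀ j) * φ i (ξ j)` is itself a residual of `w₀` on `φ i` and controls both
`w - w₀` and its action on `g`. -/
theorem norm_fitted_residual_le {φ : Fin s → ℝ → ℝ} {g : ℝ → E} {α : Fin s → E}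
    {ξ w w₀ : Fin s → ℝ} {K C h γ : ℝ} {U : Fin s → ℝ} {M r : ℕ} {X : Fin s → ℝ} {Xy G : E}
    (hK0 : 0 ≤ K) (hC0 : 0 ≤ C) (hh : 0 < h) (hh1 : h ≤ 1) (hM : s ≤ M)
    (hK : ∀ D : Fin s → ℝ, h ^ s * ‖D‖ ≤ K * h * ‖fun i => ∑ j, D j * φ i (ξ j)‖)
    (hA : ∀ D : Fin s → ℝ, ‖∑ j, D j • g (ξ j) - ∑ i, (∑ j, D j * φ i (ξ j)) • α i‖
      ≤ K * h * ‖fun i => ∑ j, D j * φ i (ξ j)‖)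
    (hα : ∀ i, ‖α i‖ ≤ K) (hU : ∀ i, |γ * U i| ≤ C) (hUM : ∀ i, |γ * U i| * h ^ (s + 1) ≤ C * h ^ M)
    (hX : ∀ i, X i = h ^ r * ∑ j, w j * φ i (ξ j))
    (hX₀ : ∀ i, |X i - h ^ r * ∑ j, w₀ j * φ i (ξ j) - h ^ (s + r) * γ * U i| ≤ C * h ^ (M + r))
    (hXy : ‖Xy - h ^ r • ∑ j, w₀ j • g (ξ j) - (h ^ (s + r) * γ) • G‖ ≤ C * h ^ (M + r)) :
    ‖w - w₀‖ ≤ 2 * K * C * h ∧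
    ‖Xy - h ^ r • ∑ j, w j • g (ξ j) - (h ^ (s + r) * γ) • (G - ∑ i, U i • α i)‖
      ≤ (C + (2 * K * C + s * (C * K))) * h ^ (M + r) := by
  set z : Fin s → ℝ := fun i => ∑ j, (w - w₀) j * φ i (ξ j) with hzdef
  have hrpos : 0 < h ^ r := by positivity
  have hz : ∀ i, |z i - h ^ s * (γ * U i)| ≤ C * h ^ M := by
    intro i
    have h1 : X i - h ^ r * ∑ j, w₀ j * φ i (ξ j) - h ^ (s + r) * γ * U i =
        h ^ r * (z i - h ^ s * (γ * U i)) := by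
      rw [hX i]
      simp only [hzdef, Pi.sub_apply, sub_mul, Finset.sum_sub_distrib]
      ring
    have h2 := hX₀ i
    rw [h1, abs_mul, abs_of_pos hrpos, pow_add, ← mul_assoc C, mul_comm (h ^ r)] at h2
    exact le_of_mul_le_mul_right h2 hrpos
  have hz1 : ∀ i, |z i| ≤ h ^ s * |γ * U i| + C * h ^ M := by
    intro i
    have h1 : z i = h ^ s * (γ * U i) + (z i - h ^ s * (γ * U i)) := by ring
    rw [h1]
    refine (abs_add_le _ _).trans (add_le_add ?_ (hz i))
    rw [abs_mul, abs_of_pos (by positivity : 0 < h ^ s)]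
  have hzs : ‖z‖ ≤ 2 * C * h ^ s := by
    rw [pi_norm_le_iff_of_nonneg (by positivity)]
    intro i
    have h1 : h ^ M ≤ h ^ s := pow_le_pow_of_le_one hh.le hh1 hM
    calc ‖z i‖ ≤ h ^ s * |γ * U i| + C * h ^ M := hz1 i
      _ ≤ h ^ s * C + C * h ^ s := by gcongr; exact hU i
      _ = _ := by ring
  have hzM : h * ‖z‖ ≤ 2 * C * h ^ M := by
    have : ‖h • z‖ ≤ 2 * C * h ^ M := by
      rw [pi_norm_le_iff_of_nonneg (by positivity)]
      intro i
      have h1 : h * h ^ M ≤ h ^ M := mul_le_of_le_one_left (by positivity) hh1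
      calc ‖(h • z) i‖ = h * |z i| := by
            rw [Pi.smul_apply, norm_smul, Real.norm_eq_abs, Real.norm_eq_abs, abs_of_pos hh]
        _ ≤ h * (h ^ s * |γ * U i| + C * h ^ M) := by gcongr; exact hz1 i
        _ = |γ * U i| * h ^ (s + 1) + C * (h * h ^ M) := by ring
        _ ≤ C * h ^ M + C * h ^ M := add_le_add (hUM i) (by gcongr)
        _ = _ := by ring
    rwa [norm_smul, Real.norm_eq_abs, abs_of_pos hh] at this
  constructor
  · have h1 := hK (w - w₀)
    have h2 : h ^ s * ‖w - w₀‖ ≤ h ^ s * (2 * K * C * h) := by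
      refine h1.trans ?_
      calc K * h * ‖z‖ ≤ K * h * (2 * C * h ^ s) := by gcongr
        _ = _ := by ring
    exact le_of_mul_le_mul_left h2 (by positivity)
  · have h1 : ‖∑ j, (w - w₀) j • g (ξ j) - (h ^ s * γ) • ∑ i, U i • α i‖
        ≤ (2 * K * C + s * (C * K)) * h ^ M := by
      have h2 : ∑ j, (w - w₀) j • g (ξ j) - (h ^ s * γ) • ∑ i, U i • α i =
          (∑ j, (w - w₀) j • g (ξ j) - ∑ i, z i • α i)
          + ∑ i, (z i - h ^ s * (γ * U i)) • α i := by
        simp only [sub_smul, Finset.sum_sub_distrib, Finset.smul_sum, smul_smul, mul_assoc]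
        abel
      rw [h2, add_mul]
      refine (norm_add_le _ _).trans (add_le_add ((hA (w - w₀)).trans ?_) ?_)
      · calc K * h * ‖z‖ = K * (h * ‖z‖) := by ring
          _ ≤ K * (2 * C * h ^ M) := by gcongr
          _ = _ := by ring
      · refine (norm_sum_le_of_le (n := fun _ => C * h ^ M * K) _ fun i _ => ?_).trans ?_
        · rw [norm_smul]
          exact mul_le_mul (hz i) (hα i) (norm_nonneg _) (by positivity)
        · rw [Finset.sum_const, Finset.card_univ, Fintype.card_fin, nsmul_eq_mul]
          exact le_of_eq (by ring)
    have h3 : Xy - h ^ r • ∑ j, w j • g (ξ j) - (h ^ (s + r) * γ) • (G - ∑ i, U i • α i) =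
        (Xy - h ^ r • ∑ j, w₀ j • g (ξ j) - (h ^ (s + r) * γ) • G)
        - h ^ r • (∑ j, (w - w₀) j • g (ξ j) - (h ^ s * γ) • ∑ i, U i • α i) := by
      have h4 : (h ^ (s + r) * γ) = h ^ r * (h ^ s * γ) := by ring
      simp only [Pi.sub_apply, sub_smul, Finset.sum_sub_distrib, smul_sub, h4, mul_smul]
      abel
    rw [h3, add_mul]
    refine (norm_sub_le _ _).trans (add_le_add hXy ?_)
    rw [norm_smul, Real.norm_eq_abs, abs_of_pos hrpos, pow_add, mul_comm (h ^ r), ← mul_assoc]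
    exact mul_le_mul_of_nonneg_right h1 hrpos.le

end Residuals

/-! ### Functionally fitted methods for small stepsizes -/

section FittedExpansion

variable {E : Type*} [NormedAddCommGroup E] [NormedSpace ℝ E] {s : ℕ}

/-- Residuals and coefficients of a functionally fitted method for small stepsizes: the
coefficients are bounded, `d` is close to its classical value, and the residuals along a smooth
triple `y, v = y', g = y''` have the same orders as those of the classical weights. -/
theorem PseudoTwoStepRKN.IsFunctionallyFitted.exists_residual_le {M : PseudoTwoStepRKN s}
    {a b : ℝ} (hab : a < b) {u : Fin s → ℝ → ℝ}
    (hfit : M.IsFunctionallyFitted (Icc a b) u) (hc : Function.Injective M.c)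
    (hu : ∀ i, ContDiffOn ℝ (s + 5 : ℕ) (u i) (Icc a b))
    (hW : ∀ t ∈ Icc a b, wronskianSnd (Icc a b) u t ≠ 0)
    {dw bw : Fin s → ℝ} {A : Fin s → Fin s → ℝ} {γ : Fin s → ℝ}
    (hw : IsClassicalWeights M.c dw bw A γ) {y v g : ℝ → E}
    (hg : ContDiffOn ℝ (s + 3 : ℕ) g (Icc a b))
    (hy : ∀ x ∈ Icc a b, HasDerivWithinAt y (v x) (Icc a b) x)
    (hv : ∀ x ∈ Icc a b, HasDerivWithinAt v (g x) (Icc a b) x) :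
    ∃ (q : ℝ → E) (C h₀ : ℝ), 0 ≤ C ∧ 0 < h₀ ∧ h₀ ≤ 1 ∧ ∀ t ∈ Icc a b, ‖q t‖ ≤ C ∧
      ∀ h : ℝ, 0 < h → h ≤ h₀ → t + h ∈ Icc a b → (∀ j, t + M.c j * h ∈ Icc a b) →
      ‖M.d t h - dw‖ ≤ C * h ∧ ‖M.b t h‖ ≤ C ∧
      ‖v (t + h) - v t - h • ∑ j, M.d t h j • g (t + M.c j * h)‖ ≤ C * h ^ (s + 4) ∧
      ‖y (t + h) - y t - h • v t - h ^ 2 • ∑ j, M.b t h j • g (t + M.c j * h)‖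
        ≤ C * h ^ (s + 4) ∧
      ∀ i, t + h + M.c i * h ∈ Icc a b → ‖M.A t h i‖ ≤ C ∧
        ‖y (t + h + M.c i * h) - y (t + h) - (h * M.c i) • v (t + h)
          - h ^ 2 • ∑ j, M.A t h i j • g (t + M.c j * h)
          - (h ^ (s + 2) * γ i) • q t‖ ≤ C * h ^ (s + 3) := by
  have hU := uniqueDiffOn_Icc hab
  let φ : Fin s → ℝ → ℝ := fun i => iteratedDerivWithin 2 (u i) (Icc a b)
  have hφ : ∀ i, ContDiffOn ℝ (s + 3 : ℕ) (φ i) (Icc a b) := fun i =>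
    ContDiffOn.iteratedDerivWithin_nat (N := s + 3) (j := 2) hU (hu i)
  have hφs : ∀ i, ContDiffOn ℝ s (φ i) (Icc a b) := fun i =>
    (hφ i).of_le (by exact_mod_cast (by omega))
  have hu1 : ∀ i, ∀ x ∈ Icc a b,
      HasDerivWithinAt (u i) (derivWithin (u i) (Icc a b) x) (Icc a b) x := fun i x hx => by
    simpa [iteratedDerivWithin_one] using
      (hu i).hasDerivWithinAt_iteratedDerivWithin hU (k := 0) (by omega) hx
  have hu2 : ∀ i, ∀ x ∈ Icc a b,
      HasDerivWithinAt (derivWithin (u i) (Icc a b)) (φ i x) (Icc a b) x := fun i x hx => by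
    have := (hu i).hasDerivWithinAt_iteratedDerivWithin hU (k := 1) (by omega) hx
    rwa [iteratedDerivWithin_one] at this
  have hWφ : ∀ t ∈ Icc a b,
      (Matrix.of fun k i : Fin s => iteratedDerivWithin (k : ℕ) (φ i) (Icc a b) t).det ≠ 0 := by
    intro t ht
    simpa only [φ, iteratedDerivWithin_iteratedDerivWithin, wronskianSnd] using hW t ht
  obtain ⟨C₁, h₁, hC₁, hh₁, hh₁1, hD⟩ := exists_norm_weights_le hab hφs hWφ hc
  obtain ⟨α, C₂, hC₂, hα⟩ := exists_local_approximation hab hφs hWφ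
    (hg.of_le (by exact_mod_cast (by omega)) : ContDiffOn ℝ s g (Icc a b))
  obtain ⟨C₃, hC₃, hRy⟩ := hw.exists_residual_le hab hg hy hv
  choose C₄ hC₄ hRu using fun i => hw.exists_residual_le hab (hφ i) (hu1 i) (hu2 i)
  choose C₅ hC₅ hUb using fun i => exists_norm_taylorCoeff_le hab (hφ i)
  obtain ⟨C₆, hC₆, hGb⟩ := exists_norm_taylorCoeff_le hab hg
  let U : Fin s → ℝ → ℝ := fun i t => taylorCoeff (Icc a b) (φ i) s t
  let K := C₁ + C₂ + s * (C₂ * ‖M.c‖ ^ s) * C₁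
  let S₄ := ∑ i, C₄ i
  let S₅ := ∑ i, C₅ i
  have hS₄ : 0 ≤ S₄ := Finset.sum_nonneg fun i _ => hC₄ i
  have hS₅ : 0 ≤ S₅ := Finset.sum_nonneg fun i _ => hC₅ i
  have hS₄i : ∀ i, C₄ i ≤ S₄ := fun i =>
    Finset.single_le_sum (f := C₄) (fun i _ => hC₄ i) (Finset.mem_univ i)
  have hS₅i : ∀ i, C₅ i ≤ S₅ := fun i =>
    Finset.single_le_sum (f := C₅) (fun i _ => hC₅ i) (Finset.mem_univ i)
  let C := C₃ + S₄ + ‖γ‖ * S₅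
  have hK : 0 ≤ K := by positivity
  have hC : 0 ≤ C := by positivity
  have hC₃C : C₃ ≤ C := by
    have : 0 ≤ ‖γ‖ * S₅ := by positivity
    simp only [C]; linarith
  have hC₄C : ∀ i, C₄ i ≤ C := by
    intro i
    have : 0 ≤ ‖γ‖ * S₅ := by positivity
    have := hS₄i i
    simp only [C]; linarith
  have hUC : ∀ k i, ∀ t ∈ Icc a b, |γ k * U i t| ≤ C := by
    intro k i t ht
    rw [abs_mul]
    have h1 : |γ k| * |U i t| ≤ ‖γ‖ * S₅ := mul_le_mul (norm_le_pi_norm γ k)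
      ((hUb i s (by omega) t ht).trans (hS₅i i)) (abs_nonneg _) (norm_nonneg _)
    simp only [C]; linarith
  let KD := 2 * K * C
  let KR := C + (2 * K * C + s * (C * K))
  have hKD : 0 ≤ KD := by positivity
  have hKR : 0 ≤ KR := by positivity
  let Kq := C₆ + s * (S₅ * C₂)
  have hKq : 0 ≤ Kq := by positivity
  refine ⟨fun t => taylorCoeff (Icc a b) g s t - ∑ i, U i t • α t i,
    KD + KR + Kq + ‖dw‖ + ‖bw‖ + ‖A‖, h₁, by positivity, hh₁, hh₁1, fun t ht => ⟨?_, ?_⟩⟩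
  · have h1 : ‖∑ i, U i t • α t i‖ ≤ s * (S₅ * C₂) := by
      refine (norm_sum_le_of_le (n := fun _ => S₅ * C₂) _ fun i _ => ?_).trans (by simp)
      rw [norm_smul]
      exact mul_le_mul ((hUb i s (by omega) t ht).trans (hS₅i i)) ((hα t ht).1 i)
        (norm_nonneg _) hS₅
    have h2 : ‖taylorCoeff (Icc a b) g s t - ∑ i, U i t • α t i‖ ≤ Kq :=
      (norm_sub_le _ _).trans (add_le_add (hGb s (by omega) t ht) h1)
    have := norm_nonneg dw
    have := norm_nonneg bw
    have := norm_nonneg A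
    linarith
  intro h hh hhh₁ hth hnode
  have hh1 : h ≤ 1 := hhh₁.trans hh₁1
  have hDK : ∀ D : Fin s → ℝ,
      h ^ s * ‖D‖ ≤ K * h * ‖fun i => ∑ j, D j * φ i (t + M.c j * h)‖ := by
    intro D
    refine (hD t ht h hh hhh₁ hnode D).trans ?_
    gcongr
    have : 0 ≤ s * (C₂ * ‖M.c‖ ^ s) * C₁ := by positivity
    simp only [K]; linarith
  have hDA : ∀ D : Fin s → ℝ, ‖∑ j, D j • g (t + M.c j * h)
      - ∑ i, (∑ j, D j * φ i (t + M.c j * h)) • α t i‖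
      ≤ K * h * ‖fun i => ∑ j, D j * φ i (t + M.c j * h)‖ := by
    intro D
    refine (norm_sum_smul_sub_le hC₂ hh.le (hα t ht).2 hnode D).trans ?_
    calc s * (C₂ * ‖M.c‖ ^ s) * (h ^ s * ‖D‖)
        ≤ s * (C₂ * ‖M.c‖ ^ s) * (C₁ * h * ‖fun i => ∑ j, D j * φ i (t + M.c j * h)‖) :=
          mul_le_mul_of_nonneg_left (hD t ht h hh hhh₁ hnode D) (by positivity)
      _ = s * (C₂ * ‖M.c‖ ^ s) * C₁ * h * ‖fun i => ∑ j, D j * φ i (t + M.c j * h)‖ := by ring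
      _ ≤ _ := by gcongr; simp only [K]; linarith
  have hαK : ∀ i, ‖α t i‖ ≤ K := by
    intro i
    have : 0 ≤ s * (C₂ * ‖M.c‖ ^ s) * C₁ := by positivity
    have := (hα t ht).1 i
    simp only [K]; linarith
  -- a vanishing determinant would give nonzero weights that annihilate all `φ i`
  have hdet : (PseudoTwoStepRKN.collocationMatrix (Icc a b) u M.c t h).det ≠ 0 := by
    intro h0
    obtain ⟨D, hD0, hDF⟩ := Matrix.exists_vecMul_eq_zero_iff.2 h0
    have h1 : (fun i => ∑ j, D j * φ i (t + M.c j * h)) = 0 := hDF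
    have h2 := hDK D
    rw [h1, norm_zero, mul_zero] at h2
    have h3 : 0 < h ^ s * ‖D‖ := by have := norm_pos_iff.2 hD0; positivity
    linarith
  have hex := hfit t h hh ht hth hnode hdet
  obtain ⟨hy₁, hy₂, hy₃⟩ := hRy t ht h hh hth hnode
  have hpow : ∀ n, h ^ n ≥ 0 := fun n => by positivity
  have hdres := norm_fitted_residual_le (φ := φ) (g := g) (α := α t)
    (ξ := fun j => t + M.c j * h) (w := M.d t h) (w₀ := dw) (γ := 0) (U := fun i => U i t)
    (M := s + 3) (r := 1) (G := taylorCoeff (Icc a b) g s t)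
    (X := fun i => derivWithin (u i) (Icc a b) (t + h) - derivWithin (u i) (Icc a b) t)
    (Xy := v (t + h) - v t) hK hC hh hh1 (by omega) hDK hDA hαK
    (fun i => by simpa using hC) (fun i => by simp only [zero_mul, abs_zero]; positivity)
    (fun i => by rw [(hex i).2.1]; ring)
    (fun i => by
      have h1 := (hRu i t ht h hh hth hnode).1
      simp only [smul_eq_mul, Real.norm_eq_abs] at h1
      simpa using h1.trans (mul_le_mul_of_nonneg_right (hC₄C i) (hpow _)))
    (by simpa using hy₁.trans (mul_le_mul_of_nonneg_right hC₃C (hpow _)))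
  have hbres := norm_fitted_residual_le (φ := φ) (g := g) (α := α t)
    (ξ := fun j => t + M.c j * h) (w := M.b t h) (w₀ := bw) (γ := 0) (U := fun i => U i t)
    (M := s + 2) (r := 2) (G := taylorCoeff (Icc a b) g s t)
    (X := fun i => u i (t + h) - u i t - h * derivWithin (u i) (Icc a b) t)
    (Xy := y (t + h) - y t - h • v t) hK hC hh hh1 (by omega) hDK hDA hαK
    (fun i => by simpa using hC) (fun i => by simp only [zero_mul, abs_zero]; positivity)
    (fun i => by rw [(hex i).1]; ring)
    (fun i => by
      have h1 := (hRu i t ht h hh hth hnode).2.1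
      simp only [smul_eq_mul, Real.norm_eq_abs] at h1
      simpa using h1.trans (mul_le_mul_of_nonneg_right (hC₄C i) (hpow _)))
    (by simpa using hy₂.trans (mul_le_mul_of_nonneg_right hC₃C (hpow _)))
  have hn1 := norm_nonneg dw
  have hn2 := norm_nonneg bw
  have hn3 := norm_nonneg A
  have hRC : ∀ n, KR * h ^ n ≤ (KD + KR + Kq + ‖dw‖ + ‖bw‖ + ‖A‖) * h ^ n := fun n =>
    mul_le_mul_of_nonneg_right (by linarith) (hpow n)
  have hKDh : KD * h ≤ KD := mul_le_of_le_one_right hKD hh1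
  refine ⟨hdres.1.trans (mul_le_mul_of_nonneg_right (by linarith) hh.le), ?_, ?_, ?_,
    fun i hi => ?_⟩
  · have h1 : ‖M.b t h‖ ≤ ‖M.b t h - bw‖ + ‖bw‖ := norm_le_norm_sub_add _ _
    have h2 : ‖M.b t h - bw‖ ≤ KD * h := hbres.1
    linarith
  · simpa using hdres.2.trans (hRC _)
  · simpa using hbres.2.trans (hRC _)
  have hAres := norm_fitted_residual_le (φ := φ) (g := g) (α := α t)
    (ξ := fun j => t + M.c j * h) (w := M.A t h i) (w₀ := A i) (γ := γ i) (U := fun i => U i t)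
    (M := s + 1) (r := 2) (G := taylorCoeff (Icc a b) g s t)
    (X := fun l => u l (t + h + M.c i * h) - u l (t + h)
      - h * M.c i * derivWithin (u l) (Icc a b) (t + h))
    (Xy := y (t + h + M.c i * h) - y (t + h) - (h * M.c i) • v (t + h))
    hK hC hh hh1 (by omega) hDK hDA hαK
    (fun l => hUC i l t ht) (fun l => mul_le_mul_of_nonneg_right (hUC i l t ht) (hpow _))
    (fun l => by rw [(hex l).2.2 i hi]; ring)
    (fun l => by
      have h1 := (hRu l t ht h hh hth hnode).2.2 i hi
      simp only [smul_eq_mul, Real.norm_eq_abs] at h1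
      exact h1.trans (mul_le_mul_of_nonneg_right (hC₄C l) (hpow _)))
    ((hy₃ i hi).trans (mul_le_mul_of_nonneg_right hC₃C (hpow _)))
  refine ⟨?_, hAres.2.trans (hRC _)⟩
  have h1 : ‖M.A t h i‖ ≤ ‖M.A t h i - A i‖ + ‖A i‖ := norm_le_norm_sub_add _ _
  have h2 : ‖M.A t h i - A i‖ ≤ KD * h := hAres.1
  have h3 : ‖A i‖ ≤ ‖A‖ := norm_le_pi_norm A i
  linarith

end FittedExpansion

/-! ### Regularity of the solution and linearization of the right-hand side -/

section Linearization

variable {E : Type*} [NormedAddCommGroup E] [NormedSpace ℝ E]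

theorem ContDiffOn.succ_of_hasDerivWithinAt {I : Set ℝ} (hI : UniqueDiffOn ℝ I) {y v : ℝ → E}
    {n : ℕ} (hy : ∀ x ∈ I, HasDerivWithinAt y (v x) I x) (hv : ContDiffOn ℝ n v I) :
    ContDiffOn ℝ (n + 1 : ℕ) y I := by
  push_cast
  rw [contDiffOn_succ_iff_derivWithin hI]
  refine ⟨fun x hx => (hy x hx).differentiableWithinAt, by simp, ?_⟩
  exact hv.congr fun x hx => (hy x hx).derivWithin (hI x hx)

theorem PseudoTwoStepRKN.IsSolutionOn.contDiffOn {I : Set ℝ} (hI : UniqueDiffOn ℝ I)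
    {f : ℝ → E → E} {y v : ℝ → E} {m : ℕ} (hsol : IsSolutionOn I f y v)
    (hf : ContDiffOn ℝ m (fun z : ℝ × E => f z.1 z.2) (I ×ˢ univ)) : ContDiffOn ℝ m y I := by
  suffices h : ∀ n : ℕ, n ≤ m → ContDiffOn ℝ n y I from h m le_rfl
  intro n
  induction n with
  | zero =>
    intro _
    rw [Nat.cast_zero, contDiffOn_zero]
    exact fun x hx => (hsol x hx).1.continuousWithinAt
  | succ n ih =>
    intro hn
    have hg : ContDiffOn ℝ n (fun x => f x (y x)) I :=
      (hf.of_le (by exact_mod_cast (by omega))).comp (f := fun x => (x, y x))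
        (contDiffOn_id.prodMk (ih (by omega))) fun x hx => ⟨hx, mem_univ _⟩
    have hv := ContDiffOn.succ_of_hasDerivWithinAt hI (fun x hx => (hsol x hx).2) hg
    exact ContDiffOn.succ_of_hasDerivWithinAt hI (fun x hx => (hsol x hx).1)
      (hv.of_le (by exact_mod_cast (by omega)))

/-- Along a curve `y`, the increment of `f` in its second argument at a time `x` is given to first
order by a linear map that may be taken at another time `t`. -/
theorem exists_linearization [FiniteDimensional ℝ E] {a b : ℝ} (hab : a < b) {f : ℝ → E → E}
    {y : ℝ → E} {m : ℕ} (hm : 2 ≤ m)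
    (hf : ContDiffOn ℝ m (fun z : ℝ × E => f z.1 z.2) (Icc a b ×ˢ univ))
    (hy : ContDiffOn ℝ m y (Icc a b)) :
    ∃ (P : ℝ → E →L[ℝ] E) (L : ℝ), 0 ≤ L ∧ ∀ t ∈ Icc a b, ‖P t‖ ≤ L ∧
      ∀ x ∈ Icc a b, ∀ w : E, ‖y x - w‖ ≤ 1 →
        ‖f x (y x) - f x w - P t (y x - w)‖ ≤ L * (|x - t| + ‖y x - w‖) * ‖y x - w‖ := by
  have : ProperSpace E := FiniteDimensional.proper ℝ E
  set S : Set (ℝ × E) := Icc a b ×ˢ univ with hS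
  have hSU : UniqueDiffOn ℝ S := (uniqueDiffOn_Icc hab).prod uniqueDiffOn_univ
  set F : ℝ × E → E := fun z => f z.1 z.2 with hF
  have hDF : ContDiffOn ℝ 1 (fderivWithin ℝ F S) S :=
    hf.fderivWithin hSU (by exact_mod_cast (by omega : 1 + 1 ≤ m))
  obtain ⟨R, hR⟩ := isCompact_Icc.exists_bound_of_continuousOn hy.continuousOn
  set K : Set (ℝ × E) := Icc a b ×ˢ Metric.closedBall 0 (R + 1) with hK
  have hKS : K ⊆ S := prod_mono le_rfl (subset_univ _)
  have hKc : IsCompact K := isCompact_Icc.prod (isCompact_closedBall _ _)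
  have hKconv : Convex ℝ K := (convex_Icc a b).prod (convex_closedBall _ _)
  obtain ⟨Λ, hΛ⟩ := (hDF.mono hKS).exists_lipschitzOnWith one_ne_zero hKconv hKc
  obtain ⟨B, hB⟩ := hKc.exists_bound_of_continuousOn (hDF.mono hKS).continuousOn
  obtain ⟨Λy, hΛy⟩ := hy.exists_lipschitzOnWith (by exact_mod_cast (by omega : m ≠ 0))
    (convex_Icc a b) isCompact_Icc
  have hyK : ∀ t ∈ Icc a b, (t, y t) ∈ K := fun t ht =>
    ⟨ht, by rw [mem_closedBall_zero_iff]; linarith [hR t ht]⟩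
  have hcomp : ∀ T : ℝ × E →L[ℝ] E, ‖T.comp (ContinuousLinearMap.inr ℝ ℝ E)‖ ≤ ‖T‖ := fun T =>
    ContinuousLinearMap.opNorm_le_bound _ (norm_nonneg _) fun w => by
      refine (T.le_opNorm _).trans (le_of_eq ?_)
      simp
  refine ⟨fun t => (fderivWithin ℝ F S (t, y t)).comp (ContinuousLinearMap.inr ℝ ℝ E),
    max B 0 + Λ * (1 + Λy), by positivity, fun t ht => ⟨?_, fun x hx w hw => ?_⟩⟩
  · refine (hcomp _).trans (((hB _ (hyK t ht)).trans (le_max_left B 0)).trans ?_)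
    exact le_add_of_nonneg_right (by positivity)
  have hseg : segment ℝ w (y x) ⊆ Metric.closedBall 0 (R + 1) := by
    refine (convex_closedBall _ _).segment_subset ?_ ?_
    · rw [mem_closedBall_zero_iff]
      have h1 : ‖w‖ ≤ ‖y x‖ + ‖y x - w‖ := by
        have := norm_sub_norm_le w (y x)
        rw [norm_sub_rev] at this
        linarith
      linarith [hR x hx]
    · exact (hyK x hx).2
  have h1 : ∀ w' ∈ segment ℝ w (y x), HasFDerivWithinAt (f x)
      ((fderivWithin ℝ F S (x, w')).comp (ContinuousLinearMap.inr ℝ ℝ E))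
      (segment ℝ w (y x)) w' := by
    intro w' _
    have h2 : HasFDerivWithinAt F (fderivWithin ℝ F S (x, w')) S (x, w') :=
      ((hf.differentiableOn (by exact_mod_cast (by omega : m ≠ 0))) (x, w')
        ⟨hx, mem_univ _⟩).hasFDerivWithinAt
    exact h2.comp w' (hasFDerivAt_prodMk_right x w').hasFDerivWithinAt fun z _ => ⟨hx, mem_univ _⟩
  have h3 : ∀ w' ∈ segment ℝ w (y x),
      ‖(fderivWithin ℝ F S (x, w')).comp (ContinuousLinearMap.inr ℝ ℝ E)
        - (fderivWithin ℝ F S (t, y t)).comp (ContinuousLinearMap.inr ℝ ℝ E)‖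
      ≤ (max B 0 + Λ * (1 + Λy)) * (|x - t| + ‖y x - w‖) := by
    intro w' hw'
    rw [← ContinuousLinearMap.sub_comp]
    refine (hcomp _).trans ?_
    have h4 := hΛ.dist_le_mul (x, w') ⟨hx, hseg hw'⟩ (t, y t) (hyK t ht)
    rw [dist_eq_norm] at h4
    have h5 : ‖w' - y x‖ ≤ ‖y x - w‖ := by
      rw [← dist_eq_norm, ← dist_eq_norm, dist_comm w', dist_comm (y x) w]
      have := (convex_closedBall (y x) (dist w (y x))).segment_subset
        (Metric.mem_closedBall.2 le_rfl) (Metric.mem_closedBall_self dist_nonneg) hw'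
      rwa [Metric.mem_closedBall, dist_comm] at this
    have h6 : ‖y x - y t‖ ≤ Λy * |x - t| := by
      have := hΛy.dist_le_mul x hx t ht
      rwa [dist_eq_norm, Real.dist_eq] at this
    have h7 : dist (x, w') (t, y t) ≤ (1 + Λy) * (|x - t| + ‖y x - w‖) := by
      have h8 : ‖w' - y t‖ ≤ ‖w' - y x‖ + ‖y x - y t‖ := norm_sub_le_norm_sub_add_norm_sub _ _ _
      have h9 : (0 : ℝ) ≤ Λy * ‖y x - w‖ := by positivity
      have h10 : (0 : ℝ) ≤ Λy * |x - t| := by positivity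
      rw [Prod.dist_eq, Real.dist_eq, dist_eq_norm]
      refine max_le ?_ ?_
      · nlinarith [norm_nonneg (y x - w)]
      · nlinarith [abs_nonneg (x - t)]
    calc _ ≤ Λ * dist (x, w') (t, y t) := h4
      _ ≤ Λ * ((1 + Λy) * (|x - t| + ‖y x - w‖)) := by gcongr
      _ = Λ * (1 + Λy) * (|x - t| + ‖y x - w‖) := by ring
      _ ≤ _ := by gcongr; exact le_add_of_nonneg_left (le_max_right _ _)
  exact (convex_segment w (y x)).norm_image_sub_le_of_norm_hasFDerivWithin_le' h1 h3
    (left_mem_segment ℝ _ _) (right_mem_segment ℝ _ _)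

end Linearization

/-! ### Local errors and the propagation of stage errors -/

section LocalError

variable {E : Type*} [NormedAddCommGroup E] [NormedSpace ℝ E] {s : ℕ}

theorem norm_sum_smul_le_of_norm_le {w : Fin s → ℝ} {x : Fin s → E} {W X : ℝ} (hw : ‖w‖ ≤ W)
    (hx : ∀ j, ‖x j‖ ≤ X) : ‖∑ j, w j • x j‖ ≤ s * (W * X) := by
  refine (norm_sum_le_of_le (n := fun _ => W * X) _ fun j _ => ?_).trans (by simp)
  rw [norm_smul]
  exact mul_le_mul ((norm_le_pi_norm w j).trans hw) (hx j) (norm_nonneg _)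
    ((norm_nonneg _).trans hw)

/-- One step of the method, started from exact values and from a stage vector whose error is
`γ j • p`, with `p = O(h ^ (s + 2))`, up to `O(h ^ (s + 3))`. The leading term does not contribute
to `y'_{n+1}` at order `h ^ (s + 3)`, because `d` annihilates `γ` up to `O(h)`. The new stage error
has the same form, and its remainder depends on that of the old one only at order `h ^ (s + 4)`. -/
theorem PseudoTwoStepRKN.exists_local_error_le (M : PseudoTwoStepRKN s) (f : ℝ → E → E)
    (y v : ℝ → E) {dw γ : Fin s → ℝ} (hγ : ∑ j, dw j * γ j = 0) {C L K₁ : ℝ} (hC : 0 ≤ C)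
    (hL : 0 ≤ L) (hK₁ : 0 ≤ K₁) :
    ∃ K, 0 ≤ K ∧ ∀ (t h : ℝ) (Y : Fin s → E) (p : E) (P : E →L[ℝ] E), 0 < h → h ≤ 1 →
      (‖γ‖ * C + K₁) * h ≤ 1 → ‖P‖ ≤ L →
      (∀ j, ‖y (t + M.c j * h) - Y j‖ ≤ 1 →
        ‖f (t + M.c j * h) (y (t + M.c j * h)) - f (t + M.c j * h) (Y j)
          - P (y (t + M.c j * h) - Y j)‖
        ≤ L * (|t + M.c j * h - t| + ‖y (t + M.c j * h) - Y j‖) * ‖y (t + M.c j * h) - Y j‖) →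
      ‖M.d t h - dw‖ ≤ C * h → ‖M.b t h‖ ≤ C →
      ‖v (t + h) - v t - h • ∑ j, M.d t h j • f (t + M.c j * h) (y (t + M.c j * h))‖
        ≤ C * h ^ (s + 4) →
      ‖y (t + h) - y t - h • v t
        - h ^ 2 • ∑ j, M.b t h j • f (t + M.c j * h) (y (t + M.c j * h))‖ ≤ C * h ^ (s + 4) →
      ‖p‖ ≤ C * h ^ (s + 2) →
      (∀ j, ‖y (t + M.c j * h) - Y j - γ j • p‖ ≤ K₁ * h ^ (s + 3)) →
      ‖y (t + h) - M.nextY f t h (y t) (v t) Y‖ ≤ K * h ^ (s + 4) ∧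
      ‖v (t + h) - M.nextY' f t h (v t) Y‖ ≤ K * h ^ (s + 4) ∧
      ∀ (i : Fin s) (q : E), ‖M.A t h i‖ ≤ C →
        ‖y (t + h + M.c i * h) - y (t + h) - (h * M.c i) • v (t + h)
          - h ^ 2 • ∑ j, M.A t h i j • f (t + M.c j * h) (y (t + M.c j * h))
          - (h ^ (s + 2) * γ i) • q‖ ≤ C * h ^ (s + 3) →
        ‖y (t + h + M.c i * h) - M.nextStage f t h (y t) (v t) Y i - γ i • h ^ (s + 2) • q‖
          ≤ C * h ^ (s + 3) + K * h ^ (s + 4) := by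
  let Ce := ‖γ‖ * C + K₁
  let Cδ := L * (‖M.c‖ + 2) * Ce
  let Ky := C + s * (C * Cδ)
  let Kv := C + (s * (C * Cδ) + s * (‖dw‖ * (L * (‖M.c‖ + Ce) * Ce)) + s * (‖dw‖ * (L * K₁)))
  have hCe : 0 ≤ Ce := by positivity
  have hCδ : 0 ≤ Cδ := by positivity
  have hKy : 0 ≤ Ky := by positivity
  have hKv : 0 ≤ Kv := by positivity
  refine ⟨Ky + Kv + ‖M.c‖ * Kv + s * (C * Cδ), by positivity, ?_⟩
  intro t h Y p P hh hh1 hsmall hP hlin hd hb hRd hRb hp he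
  set x : Fin s → ℝ := fun j => t + M.c j * h with hx
  set e : Fin s → E := fun j => y (x j) - Y j with he'
  set δ : Fin s → E := fun j => f (x j) (y (x j)) - f (x j) (Y j) with hδ
  have hpow : h ^ (s + 3) ≤ h ^ (s + 2) := pow_le_pow_of_le_one hh.le hh1 (by omega)
  have hpow1 : h ^ (s + 2) ≤ h := by
    simpa using pow_le_pow_of_le_one hh.le hh1 (by omega : 1 ≤ s + 2)
  have hen : ∀ j, ‖e j‖ ≤ Ce * h ^ (s + 2) := by
    intro j
    have h1 : ‖e j‖ ≤ ‖e j - γ j • p‖ + ‖γ j • p‖ := norm_le_norm_sub_add _ _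
    have h2 : ‖γ j • p‖ ≤ ‖γ‖ * (C * h ^ (s + 2)) := by
      rw [norm_smul]
      exact mul_le_mul (norm_le_pi_norm γ j) hp (norm_nonneg _) (norm_nonneg _)
    calc ‖e j‖ ≤ K₁ * h ^ (s + 3) + ‖γ‖ * (C * h ^ (s + 2)) := h1.trans (add_le_add (he j) h2)
      _ ≤ K₁ * h ^ (s + 2) + ‖γ‖ * (C * h ^ (s + 2)) := by gcongr
      _ = Ce * h ^ (s + 2) := by simp only [Ce]; ring
  have henh : ∀ j, ‖e j‖ ≤ Ce * h := fun j => (hen j).trans (by gcongr)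
  have hen1 : ∀ j, ‖e j‖ ≤ 1 := fun j => (henh j).trans hsmall
  have hxt : ∀ j, |x j - t| ≤ ‖M.c‖ * h := by
    intro j
    simp only [hx]
    rw [add_sub_cancel_left, abs_mul, abs_of_pos hh]
    gcongr
    exact norm_le_pi_norm M.c j
  have hlin' : ∀ j, ‖δ j - P (e j)‖ ≤ L * (|x j - t| + ‖e j‖) * ‖e j‖ := fun j => hlin j (hen1 j)
  have hδP : ∀ j, ‖δ j - P (e j)‖ ≤ L * (‖M.c‖ + Ce) * Ce * h ^ (s + 3) := by
    intro j
    calc ‖δ j - P (e j)‖ ≤ L * (‖M.c‖ * h + Ce * h) * (Ce * h ^ (s + 2)) := by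
          refine (hlin' j).trans ?_
          gcongr
          · exact hxt j
          · exact henh j
          · exact hen j
      _ = _ := by ring
  have hPe : ∀ z : E, ‖P z‖ ≤ L * ‖z‖ := fun z => (P.le_opNorm z).trans (by gcongr)
  have hδn : ∀ j, ‖δ j‖ ≤ Cδ * h ^ (s + 2) := by
    intro j
    have h1 : ‖δ j‖ ≤ ‖δ j - P (e j)‖ + ‖P (e j)‖ := norm_le_norm_sub_add _ _
    have h2 : ‖M.c‖ * h ≤ ‖M.c‖ := mul_le_of_le_one_right (norm_nonneg _) hh1
    calc ‖δ j‖ ≤ L * (‖M.c‖ + 1) * (Ce * h ^ (s + 2)) + L * (Ce * h ^ (s + 2)) := by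
          refine h1.trans (add_le_add ((hlin' j).trans ?_) ((hPe _).trans ?_))
          · gcongr
            · exact (hxt j).trans h2
            · exact hen1 j
            · exact hen j
          · gcongr
            exact hen j
      _ = _ := by simp only [Cδ]; ring
  have hsub : ∀ w : Fin s → ℝ, ∑ j, w j • f (x j) (Y j) =
      ∑ j, w j • f (x j) (y (x j)) - ∑ j, w j • δ j := by
    intro w
    simp only [hδ, smul_sub, Finset.sum_sub_distrib]
    abel
  have hyerr : ‖y (t + h) - M.nextY f t h (y t) (v t) Y‖ ≤ Ky * h ^ (s + 4) := by
    have h1 : y (t + h) - M.nextY f t h (y t) (v t) Y =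
        (y (t + h) - y t - h • v t - h ^ 2 • ∑ j, M.b t h j • f (x j) (y (x j)))
        + h ^ 2 • ∑ j, M.b t h j • δ j := by
      rw [PseudoTwoStepRKN.nextY, hsub, smul_sub]
      abel
    rw [h1]
    calc _ ≤ C * h ^ (s + 4) + h ^ 2 * (s * (C * (Cδ * h ^ (s + 2)))) := by
          refine (norm_add_le _ _).trans (add_le_add hRb ?_)
          rw [norm_smul, Real.norm_eq_abs, abs_of_pos (by positivity : 0 < h ^ 2)]
          exact mul_le_mul_of_nonneg_left (norm_sum_smul_le_of_norm_le hb hδn) (by positivity)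
      _ = _ := by simp only [Ky]; ring
  have hverr : ‖v (t + h) - M.nextY' f t h (v t) Y‖ ≤ Kv * h ^ (s + 4) := by
    have h1 : v (t + h) - M.nextY' f t h (v t) Y =
        (v (t + h) - v t - h • ∑ j, M.d t h j • f (x j) (y (x j)))
        + h • ∑ j, M.d t h j • δ j := by
      rw [PseudoTwoStepRKN.nextY', hsub, smul_sub]
      abel
    have h2 : ∑ j, M.d t h j • δ j = ∑ j, (M.d t h - dw) j • δ j
        + ∑ j, dw j • (δ j - P (e j)) + ∑ j, dw j • P (e j - γ j • p) := by
      -- the leading part of the stage error is annihilated by `dw`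
      have h3 : ∑ j, dw j • P (γ j • p) = 0 := by
        simp only [map_smul, smul_smul, ← Finset.sum_smul, hγ, zero_smul]
      simp only [map_sub, smul_sub, Finset.sum_sub_distrib, Pi.sub_apply, sub_smul, h3]
      abel
    have h4 : ‖∑ j, M.d t h j • δ j‖ ≤ s * (C * h * (Cδ * h ^ (s + 2)))
        + s * (‖dw‖ * (L * (‖M.c‖ + Ce) * Ce * h ^ (s + 3)))
        + s * (‖dw‖ * (L * (K₁ * h ^ (s + 3)))) := by
      rw [h2]
      refine (norm_add_le _ _).trans (add_le_add ((norm_add_le _ _).trans (add_le_add ?_ ?_)) ?_)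
      · exact norm_sum_smul_le_of_norm_le hd hδn
      · exact norm_sum_smul_le_of_norm_le le_rfl hδP
      · exact norm_sum_smul_le_of_norm_le le_rfl fun j =>
          (hPe _).trans (mul_le_mul_of_nonneg_left (he j) hL)
    rw [h1]
    calc _ ≤ C * h ^ (s + 4) + h * (s * (C * h * (Cδ * h ^ (s + 2)))
          + s * (‖dw‖ * (L * (‖M.c‖ + Ce) * Ce * h ^ (s + 3)))
          + s * (‖dw‖ * (L * (K₁ * h ^ (s + 3))))) := by
          refine (norm_add_le _ _).trans (add_le_add hRd ?_)
          rw [norm_smul, Real.norm_eq_abs, abs_of_pos hh]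
          exact mul_le_mul_of_nonneg_left h4 hh.le
      _ = _ := by simp only [Kv]; ring
  have h0 : 0 ≤ s * (C * Cδ) := by positivity
  have h0' : 0 ≤ ‖M.c‖ * Kv := by positivity
  refine ⟨hyerr.trans ?_, hverr.trans ?_, fun i q hA hRA => ?_⟩
  · gcongr; linarith
  · gcongr; linarith
  · have h1 : y (t + h + M.c i * h) - M.nextStage f t h (y t) (v t) Y i
          - γ i • h ^ (s + 2) • q =
        (y (t + h + M.c i * h) - y (t + h) - (h * M.c i) • v (t + h)
          - h ^ 2 • ∑ j, M.A t h i j • f (x j) (y (x j)) - (h ^ (s + 2) * γ i) • q)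
        + (y (t + h) - M.nextY f t h (y t) (v t) Y)
        + (h * M.c i) • (v (t + h) - M.nextY' f t h (v t) Y)
        + h ^ 2 • ∑ j, M.A t h i j • δ j := by
      have h2 : M.nextStage f t h (y t) (v t) Y i = M.nextY f t h (y t) (v t) Y
          + (h * M.c i) • M.nextY' f t h (v t) Y
          + h ^ 2 • ∑ j, M.A t h i j • f (x j) (Y j) := rfl
      rw [h2, hsub, smul_smul, mul_comm (γ i)]
      simp only [smul_sub]
      abel
    have hpow4 : h * h ^ (s + 4) ≤ h ^ (s + 4) := mul_le_of_le_one_left (by positivity) hh1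
    rw [h1]
    calc _ ≤ C * h ^ (s + 3) + Ky * h ^ (s + 4) + h * ‖M.c‖ * (Kv * h ^ (s + 4))
          + h ^ 2 * (s * (C * (Cδ * h ^ (s + 2)))) := by
          refine (norm_add_le _ _).trans (add_le_add ((norm_add_le _ _).trans (add_le_add
            ((norm_add_le _ _).trans (add_le_add hRA hyerr)) ?_)) ?_)
          · rw [norm_smul, Real.norm_eq_abs, abs_mul, abs_of_pos hh]
            have := norm_le_pi_norm M.c i
            rw [Real.norm_eq_abs] at this
            gcongr
          · rw [norm_smul, Real.norm_eq_abs, abs_of_pos (by positivity : 0 < h ^ 2)]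
            exact mul_le_mul_of_nonneg_left (norm_sum_smul_le_of_norm_le hA hδn) (by positivity)
      _ = C * h ^ (s + 3) + (Ky * h ^ (s + 4) + ‖M.c‖ * Kv * (h * h ^ (s + 4))
          + s * (C * Cδ) * h ^ (s + 4)) := by ring
      _ ≤ C * h ^ (s + 3) + (Ky * h ^ (s + 4) + ‖M.c‖ * Kv * h ^ (s + 4)
          + s * (C * Cδ) * h ^ (s + 4)) := by gcongr
      _ ≤ _ := by
          have : 0 ≤ Kv * h ^ (s + 4) := by positivity
          linarith

end LocalError

/-! ### Step order -/

section StepOrder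

variable {s : ℕ}

/-- The stage errors of a local run have the form `γ j • p` up to `O(h ^ (s + 3))` at every step:
each step starts from exact values, so the errors do not accumulate, and the constant of the
remainder is preserved once `h` is small. -/
theorem PseudoTwoStepRKN.IsFunctionallyFitted.hasStepOrder {M : PseudoTwoStepRKN s}
    {E : Type*} [NormedAddCommGroup E] [NormedSpace ℝ E] [FiniteDimensional ℝ E]
    {t₀ T : ℝ} (hT : 0 < T) {u : Fin s → ℝ → ℝ}
    (hfit : M.IsFunctionallyFitted (Icc t₀ (t₀ + T)) u) (hc : Function.Injective M.c)
    (hS : SuperconvergenceConditions M.c)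
    (hu : ∀ i, ContDiffOn ℝ (s + 5 : ℕ) (u i) (Icc t₀ (t₀ + T)))
    (hW : ∀ t ∈ Icc t₀ (t₀ + T), wronskianSnd (Icc t₀ (t₀ + T)) u t ≠ 0) :
    M.HasStepOrder E t₀ T (s + 5) (s + 3) (s + 3) := by
  have hab : t₀ < t₀ + T := by linarith
  set I := Icc t₀ (t₀ + T) with hI
  intro f y v hf hsol K₀
  obtain ⟨dw, bw, A, γ, hw⟩ := hS.exists_isClassicalWeights hc
  have hy : ContDiffOn ℝ (s + 5 : ℕ) y I := hsol.contDiffOn (uniqueDiffOn_Icc hab) hf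
  have hg : ContDiffOn ℝ (s + 3 : ℕ) (fun x => f x (y x)) I :=
    (hf.comp (f := fun x => (x, y x)) (contDiffOn_id.prodMk hy)
      fun x hx => ⟨hx, mem_univ _⟩).of_le (by exact_mod_cast (by omega))
  obtain ⟨q, C, h₁, hC, hh₁, hh₁1, hres⟩ := hfit.exists_residual_le hab hc hu hW hw hg
    (fun x hx => (hsol x hx).1) (fun x hx => (hsol x hx).2)
  obtain ⟨P, L, hL, hP⟩ := exists_linearization hab (by omega) hf hy
  let K₁ := |K₀| + C + 1
  have hK₁ : 0 ≤ K₁ := by positivity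
  obtain ⟨K, hK, hloc⟩ := M.exists_local_error_le f y v hw.sum_d_mul_defect hC hL hK₁
  refine ⟨K, min h₁ (min (1 / (‖γ‖ * C + K₁ + 1)) (1 / (K + 1))), by positivity, ?_⟩
  intro τ h Y hh hh₀ hrun hstart n hn
  have hhh₁ : h ≤ h₁ := hh₀.trans (min_le_left _ _)
  have hh1 : h ≤ 1 := hhh₁.trans hh₁1
  have hsmall : (‖γ‖ * C + K₁) * h ≤ 1 := by
    have h2 := hh₀.trans ((min_le_right _ _).trans (min_le_left _ _))
    rw [le_div_iff₀ (by positivity)] at h2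
    linarith
  have hKh : K * h ≤ 1 := by
    have h2 := hh₀.trans ((min_le_right _ _).trans (min_le_right _ _))
    rw [le_div_iff₀ (by positivity)] at h2
    linarith
  have hstage : ∀ k ≤ n, ∃ p : E, ‖p‖ ≤ C * h ^ (s + 2) ∧
      ∀ j, ‖y (τ + k * h + M.c j * h) - Y k j - γ j • p‖ ≤ K₁ * h ^ (s + 3) := by
    intro k
    induction k with
    | zero =>
      intro _
      refine ⟨0, by rw [norm_zero]; positivity, fun j => ?_⟩
      rw [Nat.cast_zero, zero_mul, add_zero, smul_zero, sub_zero]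
      refine (hstart j).trans (mul_le_mul_of_nonneg_right ?_ (by positivity))
      have := le_abs_self K₀
      simp only [K₁]; linarith
    | succ k ih =>
      intro hk
      obtain ⟨p, hp, he⟩ := ih (by omega)
      obtain ⟨ht, hth, hnode⟩ := hn k (by omega)
      obtain ⟨hq, hres'⟩ := hres _ ht
      obtain ⟨hd, hb, hRd, hRb, hRA⟩ := hres' h hh hhh₁ hth hnode
      have hnext := (hloc (τ + k * h) h (Y k) p (P (τ + k * h)) hh hh1 hsmall (hP _ ht).1
        (fun j => (hP _ ht).2 _ (hnode j) _) hd hb hRd hRb hp he).2.2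
      refine ⟨h ^ (s + 2) • q (τ + k * h), ?_, fun j => ?_⟩
      · rw [norm_smul, Real.norm_eq_abs, abs_of_pos (by positivity), mul_comm]
        gcongr
      · have ht' : τ + ((k + 1 : ℕ) : ℝ) * h = τ + k * h + h := by push_cast; ring
        have hj := (hn (k + 1) hk).2.2 j
        rw [ht'] at hj ⊢
        rw [hrun k]
        refine (hnext j _ (hRA j hj).1 (hRA j hj).2).trans ?_
        calc C * h ^ (s + 3) + K * h ^ (s + 4) = (C + K * h) * h ^ (s + 3) := by ring
          _ ≤ K₁ * h ^ (s + 3) := by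
            gcongr
            have := abs_nonneg K₀
            simp only [K₁]; linarith
  obtain ⟨p, hp, he⟩ := hstage n le_rfl
  obtain ⟨ht, hth, hnode⟩ := hn n le_rfl
  obtain ⟨hd, hb, hRd, hRb, -⟩ := (hres _ ht).2 h hh hhh₁ hth hnode
  have hfinal := hloc (τ + n * h) h (Y n) p (P (τ + n * h)) hh hh1 hsmall (hP _ ht).1
    (fun j => (hP _ ht).2 _ (hnode j) _) hd hb hRd hRb hp he
  exact ⟨hfinal.1, hfinal.2.1⟩

theorem wronskianSnd_monomialBasis_ne_zero {a b : ℝ} (hab : a < b) {t : ℝ} (ht : t ∈ Icc a b) :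
    wronskianSnd (Icc a b) (monomialBasis s) t ≠ 0 := by
  have hentry : ∀ k i : Fin s,
      iteratedDerivWithin ((k : ℕ) + 2) (monomialBasis s i) (Icc a b) t =
        (((i : ℕ) + 2).descFactorial ((k : ℕ) + 2) : ℝ) * t ^ ((i : ℕ) - k) := by
    intro k i
    unfold monomialBasis
    rw [iteratedDerivWithin_pow ht (uniqueDiffOn_Icc hab), Nat.add_sub_add_right]
  have htri : Matrix.BlockTriangular (Matrix.of fun k i : Fin s =>
      iteratedDerivWithin ((k : ℕ) + 2) (monomialBasis s i) (Icc a b) t) id := by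
    intro k i hki
    have : (i : ℕ) < k := hki
    rw [Matrix.of_apply, hentry, Nat.descFactorial_eq_zero_iff_lt.2 (by omega)]
    simp
  rw [wronskianSnd, Matrix.det_of_isUpperTriangular htri]
  refine Finset.prod_ne_zero_iff.2 fun i _ => ?_
  rw [Matrix.of_apply, hentry, Nat.sub_self, pow_zero, mul_one, Nat.descFactorial_self]
  positivity

end StepOrder

theorem mainTheorem1 (s : ℕ) :
    ∃ m : ℕ,
      ∀ (E : Type*) [NormedAddCommGroup E] [NormedSpace ℝ E] [FiniteDimensional ℝ E]
        (M : PseudoTwoStepRKN s) (t₀ T : ℝ),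
        0 < T → Function.Injective M.c → SuperconvergenceConditions M.c →
        (∀ u : Fin s → ℝ → ℝ,
          (∀ i, ContDiffOn ℝ m (u i) (Icc t₀ (t₀ + T))) →
          (∀ t ∈ Icc t₀ (t₀ + T), wronskianSnd (Icc t₀ (t₀ + T)) u t ≠ 0) →
          M.IsFunctionallyFitted (Icc t₀ (t₀ + T)) u →
          M.HasStepOrder E t₀ T m (s + 3) (s + 3)) ∧
        (M.IsFunctionallyFitted (Icc t₀ (t₀ + T)) (monomialBasis s) →
          M.HasStepOrder E t₀ T m (s + 3) (s + 3)) := by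
  refine ⟨s + 5, fun E _ _ _ M t₀ T hT hc hS =>
    ⟨fun u hu hW hfit => hfit.hasStepOrder hT hc hS hu hW, fun hfit => ?_⟩⟩
  exact hfit.hasStepOrder hT hc hS (fun i => (contDiff_id.pow _).contDiffOn)
    fun t ht => wronskianSnd_monomialBasis_ne_zero (by linarith) ht
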